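/- All Hilbert spaces are finite-dimensional. Let $S$ be a quantum system with Hamiltonian $H_S$, and let $\{P_k\}$ be a projective measurement on $S$, i.e. $P_k=P_k^\dagger=P_k^2$ and $\sum_k P_k=\mathbb 1$. Let $M$ be a memory with Hamiltonian $H_M$. An implementation of $\{P_k\}$ is a triple $(\rho_M,U_{SM},\{Q_k\})$ of a state $\rho_M$ of $M$, a unitary $U_{SM}$ on $S\otimes M$ and projections $Q_k=Q_k^\dagger=Q_k^2$ on $M$ with $\sum_kQ_k=\mathbb 1$, such that $$\mathrm{tr}_M\big[(\mathbb 1\otimes Q_k)U_{SM}(\rho_S\otimes\rho_M)U_{SM}^\dagger(\mathbb 1\otimes Q_k)\big]=P_k\rho_SP_k\qquad\text{for all states }\rho_S\text{ of }S\text{ and all }k .$$ Given an input state $\rho_S$, let $\rho'_{SM}=\sum_k(\mathbb 1\otimes Q_k)U_{SM}(\rho_S\otimes\rho_M)U_{SM}^\dagger(\mathbb 1\otimes Q_k)$, with marginals $\rho'_S$ and $\rho'_M$. The cost of the measurement step is $$\Delta E_{\mathcal M}=\mathrm{tr}[H_S(\rho'_S-\rho_S)]+\mathrm{tr}[H_M(\rho'_M-\rho_M)].$$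 Let $k_B,T>0$. A resetting process consists of a finite-dimensional bath $B$ with a Hamiltonian $H_B$ and a unitary $U_{MB}$. It takes $\rho'_M\otimes\rho_B$, with $\rho_B=e^{-H_B/k_BT}/\mathrm{tr}[e^{-H_B/k_BT}]$, to $\rho''_{MB}=U_{MB}(\rho'_M\otimes\rho_B)U_{MB}^\dagger$, and its cost is $\mathrm{tr}[(H_M+H_B)(\rho''_{MB}-\rho'_M\otimes\rho_B)]$. The optimal reset cost $\Delta E_{\mathcal R}$ is the infimum of this cost over all resetting processes (with arbitrary finite bath) for which $\mathrm{tr}_B[\rho''_{MB}]$ lies in a given neighbourhood of $\rho_M$, in the limit of arbitrarily small neighbourhoods. **Theorem.** For every implementation $(\rho_M,U_{SM},\{Q_k\})$ of a projective measurement $\{P_k\}$, all $H_S$, $H_M$, and every input state $\rho_S$, the total energy cost $E_{\mathrm{proj}}=\Delta E_{\mathcal M}+\Delta E_{\mathcal R}$ of measurement and optimal reset is exactly $$E_{\mathrm{proj}}=\Delta E_S+k_BT\,H(\{p_k\}),\qquad \Delta E_S=\mathrm{tr}\Big[H_S\Big(\sum_kP_k\rho_SP_k-\rho_S\Big)\Big],$$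 where $p_k=\mathrm{tr}[P_k\rho_S]$ and $H(\{p_k\})=-\sum_kp_k\ln p_k$ (with $0\ln 0=0$). In particular the cost does not depend on the implementation or on $H_M$. The same equality holds if $\Delta E_{\mathcal R}$ is instead taken to be the free energy difference $F(\rho_M)-F(\rho'_M)$, where $F(\rho)=\mathrm{tr}[H_M\rho]-k_BT\,S(\rho)$ and $S(\rho)=-\mathrm{tr}[\rho\ln\rho]$. -/

import Mathlib

open scoped Kronecker Topology ComplexOrder

noncomputable section

namespace QMeas

/-- Density matrices: quantum states on the finite-dimensional Hilbert space `ℂⁿ`. -/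
structure IsState {n : Type*} [Fintype n] [DecidableEq n] (ρ : Matrix n n ℂ) : Prop where
  posSemidef : ρ.PosSemidef
  trace_eq_one : ρ.trace = 1

/-- A finite family of orthogonal projections summing to the identity. Some of them may vanish;
mutual orthogonality is a consequence. -/
structure IsProjectiveMeasurement {n k : Type*} [Fintype n] [DecidableEq n] [Fintype k]
    (P : k → Matrix n n ℂ) : Prop where
  isHermitian : ∀ i, (P i).IsHermitian
  idempotent : ∀ i, P i * P i = P i
  sum_eq_one : ∑ i, P i = 1

/-- The partial trace over the second tensor factor. -/
def traceSnd {a b : Type*} [Fintype b] (X : Matrix (a × b) (a × b) ℂ) : Matrix a a ℂ :=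
  Matrix.of fun i j => ∑ x, X (i, x) (j, x)

/-- The partial trace over the first tensor factor. -/
def traceFst {a b : Type*} [Fintype a] (X : Matrix (a × b) (a × b) ℂ) : Matrix b b ℂ :=
  Matrix.of fun i j => ∑ x, X (x, i) (x, j)

/-- The expectation value `tr[H X]` of an observable. -/
def energy {n : Type*} [Fintype n] (H X : Matrix n n ℂ) : ℝ := (H * X).trace.re

/-- The von Neumann entropy `S(ρ) = -tr[ρ ln ρ]`, with `0 ln 0 = 0`. -/
def entropy {n : Type*} [Fintype n] [DecidableEq n] (ρ : Matrix n n ℂ) : ℝ :=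
  -(ρ * cfc Real.log ρ).trace.re

/-- The free energy `F(ρ) = tr[H ρ] - kT S(ρ)`, where `kT` stands for `k_B T`. -/
def freeEnergy {n : Type*} [Fintype n] [DecidableEq n] (kT : ℝ) (H ρ : Matrix n n ℂ) : ℝ :=
  energy H ρ - kT * entropy ρ

/-- The thermal state `exp(-H / kT) / tr[exp(-H / kT)]`. -/
def thermalState {n : Type*} [Fintype n] [DecidableEq n] (kT : ℝ) (H : Matrix n n ℂ) :
    Matrix n n ℂ :=
  (NormedSpace.exp (-(kT⁻¹ • H))).trace⁻¹ • NormedSpace.exp (-(kT⁻¹ • H))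

/-- The Shannon entropy `-∑ p_k ln p_k`, with `0 ln 0 = 0`. -/
def shannonEntropy {k : Type*} [Fintype k] (p : k → ℝ) : ℝ := ∑ i, Real.negMulLog (p i)

section Measurement

variable {s m k : Type*} [Fintype s] [DecidableEq s] [Fintype m] [DecidableEq m] [Fintype k]

/-- The unnormalised state `p_k ρ'_{SM,k} = (1 ⊗ Q_k) U (ρ_S ⊗ ρ_M) U† (1 ⊗ Q_k)` of system and
memory that belongs to one outcome; the argument `Q` is the projection of this outcome. -/
def outcomeState (ρM : Matrix m m ℂ) (U : Matrix (s × m) (s × m) ℂ) (Q : Matrix m m ℂ)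
    (ρS : Matrix s s ℂ) : Matrix (s × m) (s × m) ℂ :=
  ((1 : Matrix s s ℂ) ⊗ₖ Q) * (U * (ρS ⊗ₖ ρM) * U.conjTranspose) * ((1 : Matrix s s ℂ) ⊗ₖ Q)

/-- `(ρ_M, U, {Q_k})` implements the projective measurement `{P_k}`: on every input state, each
outcome has the correct probability and the correct post-measurement state. -/
structure IsImplementation (P : k → Matrix s s ℂ) (ρM : Matrix m m ℂ)
    (U : Matrix (s × m) (s × m) ℂ) (Q : k → Matrix m m ℂ) : Prop where
  isState : IsState ρM
  unitary : U ∈ Matrix.unitaryGroup (s × m) ℂ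
  projective : IsProjectiveMeasurement Q
  faithful : ∀ ρS : Matrix s s ℂ, IsState ρS → ∀ i,
    traceSnd (outcomeState ρM U (Q i) ρS) = P i * ρS * P i

/-- The state `ρ'_{SM} = ∑_k p_k ρ'_{SM,k}` of system and memory after the measurement step. -/
def postState (ρM : Matrix m m ℂ) (U : Matrix (s × m) (s × m) ℂ) (Q : k → Matrix m m ℂ)
    (ρS : Matrix s s ℂ) : Matrix (s × m) (s × m) ℂ :=
  ∑ i, outcomeState ρM U (Q i) ρS

/-- The state `ρ'_M` of the memory after the measurement step. -/
def postMemory (ρM : Matrix m m ℂ) (U : Matrix (s × m) (s × m) ℂ) (Q : k → Matrix m m ℂ)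
    (ρS : Matrix s s ℂ) : Matrix m m ℂ :=
  traceFst (postState ρM U Q ρS)

/-- The energy cost `tr[H_S (ρ'_S - ρ_S)] + tr[H_M (ρ'_M - ρ_M)]` of the measurement step, where
`ρ'_S` and `ρ'_M` are the marginals of the state that the device produces. -/
def measurementCost (HS : Matrix s s ℂ) (HM : Matrix m m ℂ) (ρM : Matrix m m ℂ)
    (U : Matrix (s × m) (s × m) ℂ) (Q : k → Matrix m m ℂ) (ρS : Matrix s s ℂ) : ℝ :=
  energy HS (traceSnd (postState ρM U Q ρS) - ρS) + energy HM (postMemory ρM U Q ρS - ρM)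

/-- The average energy change `ΔE_S = tr[H_S (∑_k P_k ρ_S P_k - ρ_S)]` of the measured system. -/
def systemEnergyChange (HS : Matrix s s ℂ) (P : k → Matrix s s ℂ) (ρS : Matrix s s ℂ) : ℝ :=
  energy HS (∑ i, P i * ρS * P i - ρS)

end Measurement

/-- A resetting process for a memory: a bath of some finite dimension with a Hamiltonian, and a
unitary on memory and bath. -/
structure ResetProcess (m : Type*) [Fintype m] [DecidableEq m] where
  dim : ℕ
  dim_pos : 0 < dim
  HB : Matrix (Fin dim) (Fin dim) ℂ
  HB_isHermitian : HB.IsHermitian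
  U : Matrix (m × Fin dim) (m × Fin dim) ℂ
  unitary : U ∈ Matrix.unitaryGroup (m × Fin dim) ℂ

namespace ResetProcess

variable {m : Type*} [Fintype m] [DecidableEq m]

/-- The joint state `ρ'_M ⊗ ρ_B` before the process, with thermal `ρ_B`. -/
def initialJoint (R : ResetProcess m) (kT : ℝ) (ρ' : Matrix m m ℂ) :
    Matrix (m × Fin R.dim) (m × Fin R.dim) ℂ :=
  ρ' ⊗ₖ thermalState kT R.HB

/-- The joint state `U (ρ'_M ⊗ ρ_B) U†` after the process. -/
def finalJoint (R : ResetProcess m) (kT : ℝ) (ρ' : Matrix m m ℂ) :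
    Matrix (m × Fin R.dim) (m × Fin R.dim) ℂ :=
  R.U * R.initialJoint kT ρ' * R.U.conjTranspose

/-- The memory state `tr_B[U (ρ'_M ⊗ ρ_B) U†]` after the process. -/
def finalMemory (R : ResetProcess m) (kT : ℝ) (ρ' : Matrix m m ℂ) : Matrix m m ℂ :=
  traceSnd (R.finalJoint kT ρ')

/-- The energy `tr[(H_M + H_B)(ρ''_{MB} - ρ'_{MB})]` spent by the process. -/
def cost (R : ResetProcess m) (kT : ℝ) (HM ρ' : Matrix m m ℂ) : ℝ :=
  energy (HM ⊗ₖ (1 : Matrix (Fin R.dim) (Fin R.dim) ℂ) + (1 : Matrix m m ℂ) ⊗ₖ R.HB)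
    (R.finalJoint kT ρ' - R.initialJoint kT ρ')

end ResetProcess

/-- The optimal cost of resetting a memory from `ρ'` to `ρ`: the infimum of the cost over all
resetting processes that bring the memory into a prescribed neighbourhood of `ρ`, in the limit of
arbitrarily small neighbourhoods. (A finite bath cannot in general restore `ρ` exactly, for instance
when `ρ` is pure and `ρ'` is not, so the limit is needed.) -/
def optimalResetCost {m : Type*} [Fintype m] [DecidableEq m] (kT : ℝ) (HM ρ' ρ : Matrix m m ℂ) :
    EReal :=
  ⨆ V ∈ 𝓝 ρ, ⨅ R : ResetProcess m, ⨅ _ : R.finalMemory kT ρ' ∈ V, (R.cost kT HM ρ' : EReal)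

end QMeas

end

-- With `R` a square root of `ρM`, the blocks of `A i = (1 ⊗ Q i) U (1 ⊗ R)` are Kraus operators of
-- `ρ ↦ P i ρ P i`. That map has a rank-one Gram (Choi) matrix, so every block is a multiple of `P
-- i`, i.e. `A i = P i ⊗ W i` (`exists_eq_kronecker_of_kraus`). Unitarity gives `W i† W i = ρM` when
-- `P i ≠ 0`, and orthogonality of the `Q i` gives `W i† W j = 0` for `i ≠ j`. Hence the memory ends
-- in `∑ p_i W i W i†`, whose nonzero spectrum is that of `diag(p) ⊗ ρM`: its entropy has grown by
-- exactly the Shannon entropy of `p` (`postMemory_spec`).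
--
-- The optimal reset cost is the free energy difference (`optimalResetCost_eq`). The lower bound is
-- Klein's inequality for the final joint state against a product of a reference memory state and
-- the thermal bath state (`le_cost`). The upper bound swaps the memory with a long chain of small
-- baths whose distributions interpolate between the two spectra; the dissipation of the chain
-- vanishes as its length grows (`exists_reaches`). Zero eigenvalues of `ρM` are avoided on both
-- sides by mixing with the uniform distribution, which is harmless because the target is only
-- approached.
--
-- In the sum of both costs the memory energies cancel, and the entropy growth times `kT` remains.

noncomputable section

namespace QMeas

-- Gibbs distributions

section Gibbs

variable {n : Type*} [Fintype n]

/-- The Boltzmann weights of the energy levels `h`. -/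
def gibbs (kT : ℝ) (h : n → ℝ) (i : n) : ℝ :=
  (∑ j, Real.exp (-(kT⁻¹ * h j)))⁻¹ * Real.exp (-(kT⁻¹ * h i))

lemma gibbs_pos [Nonempty n] (kT : ℝ) (h : n → ℝ) (i : n) : 0 < gibbs kT h i :=
  mul_pos (inv_pos.2 (Finset.sum_pos (fun _ _ => Real.exp_pos _) Finset.univ_nonempty))
    (Real.exp_pos _)

lemma sum_gibbs [Nonempty n] (kT : ℝ) (h : n → ℝ) : ∑ i, gibbs kT h i = 1 := by
  simp only [gibbs, ← Finset.mul_sum]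
  exact inv_mul_cancel₀
    (Finset.sum_pos (fun _ _ => Real.exp_pos _) Finset.univ_nonempty).ne'

lemma log_gibbs [Nonempty n] (kT : ℝ) (h : n → ℝ) (i : n) :
    Real.log (gibbs kT h i)
      = -Real.log (∑ j, Real.exp (-(kT⁻¹ * h j))) - kT⁻¹ * h i := by
  have hZ : 0 < ∑ j, Real.exp (-(kT⁻¹ * h j)) :=
    Finset.sum_pos (fun _ _ => Real.exp_pos _) Finset.univ_nonempty
  rw [gibbs, Real.log_mul (inv_ne_zero hZ.ne') (Real.exp_pos _).ne', Real.log_inv, Real.log_exp]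
  ring

end Gibbs

-- Diagonalised matrices, entropy and Klein's inequality

/-- The Hermitian matrix with real eigenvalues `d` in the basis of columns of `V`. -/
def conjDiag {n : Type*} [Fintype n] [DecidableEq n] (V : Matrix n n ℂ) (d : n → ℝ) :
    Matrix n n ℂ :=
  V * Matrix.diagonal (fun i => (d i : ℂ)) * V.conjTranspose

section Spectral

variable {n m : Type*} [Fintype n] [DecidableEq n] [Fintype m] [DecidableEq m]

lemma isHermitian_conjDiag (V : Matrix n n ℂ) (d : n → ℝ) : (conjDiag V d).IsHermitian := by
  simp only [conjDiag, Matrix.IsHermitian, Matrix.conjTranspose_mul,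
    Matrix.conjTranspose_conjTranspose, Matrix.diagonal_conjTranspose, ← mul_assoc]
  congr 3
  ext i
  simp

lemma exists_eq_conjDiag {A : Matrix n n ℂ} (hA : A.IsHermitian) :
    ∃ V ∈ Matrix.unitaryGroup n ℂ, ∃ d : n → ℝ, A = conjDiag V d :=
  ⟨hA.eigenvectorUnitary, hA.eigenvectorUnitary.2, hA.eigenvalues, by
    conv_lhs => rw [hA.spectral_theorem]
    rfl⟩

lemma charpoly_conjDiag {V : Matrix n n ℂ} (hV : V ∈ Matrix.unitaryGroup n ℂ) (d : n → ℝ) :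
    (conjDiag V d).charpoly = ∏ i, (Polynomial.X - Polynomial.C (d i : ℂ)) := by
  have h : V.conjTranspose * V = 1 := (Unitary.mem_iff.1 hV).1
  rw [conjDiag, Matrix.charpoly_mul_comm, ← mul_assoc, h, one_mul, Matrix.charpoly_diagonal]

lemma roots_charpoly_conjDiag {V : Matrix n n ℂ} (hV : V ∈ Matrix.unitaryGroup n ℂ) (d : n → ℝ) :
    (conjDiag V d).charpoly.roots = Finset.univ.val.map fun i => (d i : ℂ) := by
  rw [charpoly_conjDiag hV, Polynomial.roots_prod]
  · simp
  · exact Finset.prod_ne_zero_iff.2 fun i _ => Polynomial.X_sub_C_ne_zero _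

lemma conjDiag_mul {V : Matrix n n ℂ} (hV : V ∈ Matrix.unitaryGroup n ℂ) (d e : n → ℝ) :
    conjDiag V d * conjDiag V e = conjDiag V (fun i => d i * e i) := by
  have h : V.conjTranspose * V = 1 := (Unitary.mem_iff.1 hV).1
  calc conjDiag V d * conjDiag V e
      = V * Matrix.diagonal (fun i => (d i : ℂ)) * (V.conjTranspose * V)
          * Matrix.diagonal (fun i => (e i : ℂ)) * V.conjTranspose := by
        simp only [conjDiag, mul_assoc]
    _ = _ := by
        rw [h, mul_one, mul_assoc V, Matrix.diagonal_mul_diagonal]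
        simp [conjDiag]

lemma trace_conjDiag {V : Matrix n n ℂ} (hV : V ∈ Matrix.unitaryGroup n ℂ) (d : n → ℝ) :
    (conjDiag V d).trace = ((∑ i, d i : ℝ) : ℂ) := by
  have h : V.conjTranspose * V = 1 := (Unitary.mem_iff.1 hV).1
  rw [conjDiag, Matrix.trace_mul_comm, ← mul_assoc, h, one_mul, Matrix.trace_diagonal]
  simp

lemma conjDiag_one {V : Matrix n n ℂ} (hV : V ∈ Matrix.unitaryGroup n ℂ) :
    conjDiag V (fun _ => 1) = 1 := by
  have h : V * V.conjTranspose = 1 := (Unitary.mem_iff.1 hV).2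
  simp [conjDiag, h]

lemma conjDiag_add (V : Matrix n n ℂ) (d e : n → ℝ) :
    conjDiag V (fun i => d i + e i) = conjDiag V d + conjDiag V e := by
  simp only [conjDiag, Complex.ofReal_add, ← Matrix.diagonal_add, mul_add, add_mul]

lemma conjDiag_smul (V : Matrix n n ℂ) (c : ℝ) (d : n → ℝ) :
    conjDiag V (fun i => c * d i) = (c : ℂ) • conjDiag V d := by
  have : Matrix.diagonal (fun i => ((c * d i : ℝ) : ℂ))
      = (c : ℂ) • Matrix.diagonal (fun i => (d i : ℂ)) := by
    rw [← Matrix.diagonal_smul]; congr 1; ext i; simp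
  rw [conjDiag, this, conjDiag, Matrix.mul_smul, Matrix.smul_mul]

lemma mul_conjDiag_mul (U V : Matrix n n ℂ) (d : n → ℝ) :
    U * conjDiag V d * U.conjTranspose = conjDiag (U * V) d := by
  simp only [conjDiag, Matrix.conjTranspose_mul, mul_assoc]

lemma conjDiag_kronecker (V : Matrix n n ℂ) (W : Matrix m m ℂ) (d : n → ℝ) (e : m → ℝ) :
    conjDiag V d ⊗ₖ conjDiag W e = conjDiag (V ⊗ₖ W) (fun x => d x.1 * e x.2) := by
  simp only [conjDiag, Matrix.mul_kronecker_mul, Matrix.diagonal_kronecker_diagonal,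
    Matrix.conjTranspose_kronecker, Complex.ofReal_mul]

lemma kronecker_mem_unitaryGroup {V : Matrix n n ℂ} (hV : V ∈ Matrix.unitaryGroup n ℂ)
    {W : Matrix m m ℂ} (hW : W ∈ Matrix.unitaryGroup m ℂ) :
    V ⊗ₖ W ∈ Matrix.unitaryGroup (n × m) ℂ :=
  Matrix.kronecker_mem_unitary hV hW

lemma entropy_eq_sum_eigenvalues {A : Matrix n n ℂ} (hA : A.IsHermitian) :
    entropy A = ∑ i, Real.negMulLog (hA.eigenvalues i) := by
  have h1 : A = conjDiag (hA.eigenvectorUnitary : Matrix n n ℂ) hA.eigenvalues := by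
    conv_lhs => rw [hA.spectral_theorem]
    rfl
  have h2 : cfc Real.log A = conjDiag (hA.eigenvectorUnitary : Matrix n n ℂ)
      (fun i => Real.log (hA.eigenvalues i)) := by
    rw [hA.cfc_eq]; rfl
  have h3 : A * cfc Real.log A = conjDiag (hA.eigenvectorUnitary : Matrix n n ℂ)
      (fun i => hA.eigenvalues i * Real.log (hA.eigenvalues i)) := by
    rw [h2, ← conjDiag_mul hA.eigenvectorUnitary.2, ← h1]
  rw [entropy, h3, trace_conjDiag hA.eigenvectorUnitary.2, Complex.ofReal_re,
    ← Finset.sum_neg_distrib]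
  exact Finset.sum_congr rfl fun i _ => by rw [Real.negMulLog, neg_mul]

/-- The entropy depends only on the characteristic polynomial, so it can be read off from any
diagonalisation and compared between matrices of different sizes. -/
lemma entropy_eq_sum_roots {A : Matrix n n ℂ} (hA : A.IsHermitian) :
    entropy A = (A.charpoly.roots.map fun z => Real.negMulLog z.re).sum := by
  rw [entropy_eq_sum_eigenvalues hA, hA.roots_charpoly_eq_eigenvalues]
  simp

lemma entropy_conjDiag {V : Matrix n n ℂ} (hV : V ∈ Matrix.unitaryGroup n ℂ) (d : n → ℝ) :
    entropy (conjDiag V d) = ∑ i, Real.negMulLog (d i) := by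
  rw [entropy_eq_sum_roots (isHermitian_conjDiag V d), roots_charpoly_conjDiag hV]
  simp

/-- The nonzero eigenvalues of `A A†` and `A† A` agree. -/
lemma entropy_mul_conjTranspose_comm (A : Matrix n m ℂ) :
    entropy (A * A.conjTranspose) = entropy (A.conjTranspose * A) := by
  rw [entropy_eq_sum_roots (Matrix.isHermitian_mul_conjTranspose_self A),
    entropy_eq_sum_roots (Matrix.isHermitian_conjTranspose_mul_self A)]
  -- The two characteristic polynomials agree up to powers of `X`, whose roots contribute `negMulLog
  -- 0 = 0`.
  have h := congrArg (fun p => (p.roots.map fun z : ℂ => Real.negMulLog z.re).sum)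
    (Matrix.charpoly_mul_comm' A A.conjTranspose)
  rw [Polynomial.roots_mul, Polynomial.roots_mul] at h
  · simpa [Multiset.map_nsmul, Multiset.sum_nsmul] using h
  · exact mul_ne_zero (pow_ne_zero _ Polynomial.X_ne_zero) (Matrix.charpoly_monic _).ne_zero
  · exact mul_ne_zero (pow_ne_zero _ Polynomial.X_ne_zero) (Matrix.charpoly_monic _).ne_zero

lemma IsState.exists_eq_conjDiag {ρ : Matrix n n ℂ} (hρ : IsState ρ) :
    ∃ V ∈ Matrix.unitaryGroup n ℂ, ∃ p : n → ℝ, ρ = conjDiag V p ∧ (∀ i, 0 ≤ p i) ∧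
      ∑ i, p i = 1 := by
  obtain ⟨V, hV, p, rfl⟩ := QMeas.exists_eq_conjDiag hρ.posSemidef.isHermitian
  refine ⟨V, hV, p, rfl, fun i => ?_, ?_⟩
  · have h := hρ.posSemidef.conjTranspose_mul_mul_same V
    have h1 : V.conjTranspose * V = 1 := (Unitary.mem_iff.1 hV).1
    have h2 : V.conjTranspose * conjDiag V p * V = Matrix.diagonal (fun i => (p i : ℂ)) := by
      calc _ = (V.conjTranspose * V) * Matrix.diagonal (fun i => (p i : ℂ))
            * (V.conjTranspose * V) := by simp only [conjDiag, mul_assoc]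
        _ = _ := by rw [h1, one_mul, mul_one]
    rw [h2, Matrix.posSemidef_diagonal_iff] at h
    exact_mod_cast h i
  · have h := hρ.trace_eq_one
    rw [trace_conjDiag hV] at h
    exact_mod_cast h

lemma isState_conjDiag {V : Matrix n n ℂ} (hV : V ∈ Matrix.unitaryGroup n ℂ) {p : n → ℝ}
    (h0 : ∀ i, 0 ≤ p i) (h1 : ∑ i, p i = 1) : IsState (conjDiag V p) where
  posSemidef := by
    refine Matrix.PosSemidef.mul_mul_conjTranspose_same ?_ V
    rw [Matrix.posSemidef_diagonal_iff]
    exact fun i => by exact_mod_cast h0 i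
  trace_eq_one := by rw [trace_conjDiag hV, h1, Complex.ofReal_one]

lemma trace_conjDiag_mul_conjDiag (V W : Matrix n n ℂ) (d e : n → ℝ) :
    (conjDiag V d * conjDiag W e).trace.re
      = ∑ i, ∑ j, d i * e j * Complex.normSq ((V.conjTranspose * W) i j) := by
  have h : (conjDiag V d * conjDiag W e).trace
      = (Matrix.diagonal (fun i => (d i : ℂ)) * (V.conjTranspose * W)
        * (Matrix.diagonal (fun i => (e i : ℂ)) * (V.conjTranspose * W).conjTranspose)).trace := by
    rw [Matrix.conjTranspose_mul, Matrix.conjTranspose_conjTranspose]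
    simp only [conjDiag, mul_assoc]
    rw [Matrix.trace_mul_comm]
    simp only [mul_assoc]
  rw [h, Matrix.trace, Complex.re_sum]
  refine Finset.sum_congr rfl fun i _ => ?_
  rw [Matrix.diag_apply, Matrix.mul_apply, Complex.re_sum]
  refine Finset.sum_congr rfl fun j _ => ?_
  rw [Matrix.diagonal_mul, Matrix.diagonal_mul, Matrix.conjTranspose_apply]
  have : (d i : ℂ) * (V.conjTranspose * W) i j * (e j * star ((V.conjTranspose * W) i j))
      = ((d i * e j * Complex.normSq ((V.conjTranspose * W) i j) : ℝ) : ℂ) := by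
    push_cast
    rw [← Complex.mul_conj]
    simp only [RCLike.star_def]
    ring
  rw [this, Complex.ofReal_re]

lemma sum_normSq_row {V : Matrix n n ℂ} (hV : V ∈ Matrix.unitaryGroup n ℂ) (i : n) :
    ∑ j, Complex.normSq (V i j) = 1 := by
  have h : (V * V.conjTranspose) i i = 1 := by
    rw [show V * V.conjTranspose = 1 from (Unitary.mem_iff.1 hV).2, Matrix.one_apply_eq]
  rw [Matrix.mul_apply] at h
  simp only [Matrix.conjTranspose_apply, RCLike.star_def, Complex.mul_conj] at h
  exact_mod_cast h

lemma sum_normSq_col {V : Matrix n n ℂ} (hV : V ∈ Matrix.unitaryGroup n ℂ) (j : n) :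
    ∑ i, Complex.normSq (V i j) = 1 := by
  have h := sum_normSq_row (V := V.conjTranspose) (Unitary.star_mem hV) j
  simpa [Matrix.conjTranspose_apply, RCLike.star_def, Complex.normSq_conj] using h

/-- This is `log x ≤ x - 1` at `x = q / p`, multiplied by `p`: the scalar form of Klein's
inequality. -/
lemma mul_log_sub_ge {p q : ℝ} (hp : 0 ≤ p) (hq : 0 < q) :
    p - q ≤ -Real.negMulLog p - p * Real.log q := by
  rcases hp.eq_or_lt with rfl | hp
  · simpa using hq.le
  · have h := Real.log_le_sub_one_of_pos (div_pos hq hp)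
    rw [Real.log_div hq.ne' hp.ne'] at h
    have h2 := mul_le_mul_of_nonneg_left h hp.le
    have h3 : p * (q / p - 1) = q - p := by field_simp
    rw [Real.negMulLog]
    linarith

/-- Klein's inequality, for a positive definite second argument. -/
lemma entropy_le_neg_trace_mul_log {V W : Matrix n n ℂ} (hV : V ∈ Matrix.unitaryGroup n ℂ)
    (hW : W ∈ Matrix.unitaryGroup n ℂ) {p q : n → ℝ} (hp : ∀ i, 0 ≤ p i) (hq : ∀ i, 0 < q i)
    (hpq : ∑ i, p i = ∑ i, q i) :
    ∑ i, Real.negMulLog (p i)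
      ≤ -(conjDiag V p * conjDiag W (fun i => Real.log (q i))).trace.re := by
  rw [trace_conjDiag_mul_conjDiag]
  have hM : V.conjTranspose * W ∈ Matrix.unitaryGroup n ℂ :=
    mul_mem (Unitary.star_mem hV) hW
  set M := V.conjTranspose * W
  have key : ∑ i, ∑ j, Complex.normSq (M i j) * (p i - q j)
      ≤ ∑ i, ∑ j, Complex.normSq (M i j) * (-Real.negMulLog (p i) - p i * Real.log (q j)) :=
    Finset.sum_le_sum fun i _ => Finset.sum_le_sum fun j _ =>
      mul_le_mul_of_nonneg_left (mul_log_sub_ge (hp i) (hq j)) (Complex.normSq_nonneg _)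
  -- The squared overlaps of the two eigenbases form a doubly stochastic matrix, so the left side of
  -- `key` is `∑ p - ∑ q = 0`.
  have row (f : n → ℝ) : ∑ i, ∑ j, Complex.normSq (M i j) * f i = ∑ i, f i :=
    Finset.sum_congr rfl fun i _ => by rw [← Finset.sum_mul, sum_normSq_row hM, one_mul]
  have col (f : n → ℝ) : ∑ i, ∑ j, Complex.normSq (M i j) * f j = ∑ i, f i := by
    rw [Finset.sum_comm]
    exact Finset.sum_congr rfl fun i _ => by rw [← Finset.sum_mul, sum_normSq_col hM, one_mul]
  simp only [mul_sub, Finset.sum_sub_distrib, row, col, hpq, sub_self] at key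
  rw [Finset.sum_neg_distrib] at key
  have e : ∑ i, ∑ j, p i * Real.log (q j) * Complex.normSq (M i j)
      = ∑ i, ∑ j, Complex.normSq (M i j) * (p i * Real.log (q j)) :=
    Finset.sum_congr rfl fun i _ => Finset.sum_congr rfl fun j _ => by ring
  rw [e]
  linarith

lemma thermalState_conjDiag {W : Matrix n n ℂ} (hW : W ∈ Matrix.unitaryGroup n ℂ) (kT : ℝ)
    (h : n → ℝ) : thermalState kT (conjDiag W h) = conjDiag W (gibbs kT h) := by
  have h1 : -(kT⁻¹ • conjDiag W h) = conjDiag W (fun i => -kT⁻¹ * h i) := by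
    rw [conjDiag_smul]
    push_cast
    rw [neg_smul, ← Complex.ofReal_inv, Complex.coe_smul]
  have hinv : W⁻¹ = W.conjTranspose := Matrix.inv_eq_left_inv (Unitary.mem_iff.1 hW).1
  have hu : IsUnit W := ⟨⟨W, W.conjTranspose, (Unitary.mem_iff.1 hW).2,
    (Unitary.mem_iff.1 hW).1⟩, rfl⟩
  have h2 : NormedSpace.exp (-(kT⁻¹ • conjDiag W h))
      = conjDiag W (fun i => Real.exp (-(kT⁻¹ * h i))) := by
    rw [h1, conjDiag, ← hinv, Matrix.exp_conj _ _ hu, Matrix.exp_diagonal, conjDiag, hinv]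
    congr 3
    ext i
    simp [Pi.coe_exp, Complex.exp_eq_exp_ℂ]
  rw [thermalState, h2, trace_conjDiag hW, ← Complex.ofReal_inv, ← conjDiag_smul]
  rfl

end Spectral

-- Partial traces

section PartialTrace

variable {s m k : Type*}

lemma traceSnd_add [Fintype m] (X Y : Matrix (s × m) (s × m) ℂ) :
    traceSnd (X + Y) = traceSnd X + traceSnd Y := by
  ext i j
  simp [traceSnd, Finset.sum_add_distrib]

lemma traceSnd_smul [Fintype m] (c : ℂ) (X : Matrix (s × m) (s × m) ℂ) :
    traceSnd (c • X) = c • traceSnd X := by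
  ext i j
  simp [traceSnd, Finset.mul_sum]

lemma traceSnd_sum [Fintype m] [Fintype k] (X : k → Matrix (s × m) (s × m) ℂ) :
    traceSnd (∑ i, X i) = ∑ i, traceSnd (X i) := by
  ext a b
  simp only [traceSnd, Matrix.of_apply, Matrix.sum_apply]
  exact Finset.sum_comm

lemma traceFst_sum [Fintype s] [Fintype k] (X : k → Matrix (s × m) (s × m) ℂ) :
    traceFst (∑ i, X i) = ∑ i, traceFst (X i) := by
  ext a b
  simp only [traceFst, Matrix.of_apply, Matrix.sum_apply]
  exact Finset.sum_comm

lemma traceFst_kronecker [Fintype s] (X : Matrix s s ℂ) (Y : Matrix m m ℂ) :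
    traceFst (X ⊗ₖ Y) = X.trace • Y := by
  ext a b
  simp [traceFst, Matrix.trace, Finset.sum_mul]

lemma kronecker_left_cancel {P : Matrix s s ℂ} (hP : P ≠ 0) {X Y : Matrix m m ℂ}
    (h : P ⊗ₖ X = P ⊗ₖ Y) : X = Y := by
  obtain ⟨a, b, hab⟩ : ∃ a b, P a b ≠ 0 := by
    by_contra! hc
    exact hP (Matrix.ext hc)
  ext x y
  have := congrFun (congrFun h (a, x)) (b, y)
  rw [Matrix.kronecker_apply, Matrix.kronecker_apply] at this
  exact mul_left_cancel₀ hab this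

lemma traceSnd_kronecker [Fintype m] (X : Matrix s s ℂ) (Y : Matrix m m ℂ) :
    traceSnd (X ⊗ₖ Y) = Y.trace • X := by
  ext a b
  simp [traceSnd, Matrix.trace, Finset.sum_mul, mul_comm (X a b)]

lemma traceSnd_kronecker_one_mul [Fintype s] [Fintype m] [DecidableEq m] (X Y : Matrix s s ℂ)
    (M : Matrix (s × m) (s × m) ℂ) :
    traceSnd ((X ⊗ₖ (1 : Matrix m m ℂ)) * M * (Y ⊗ₖ (1 : Matrix m m ℂ)))
      = X * traceSnd M * Y := by
  ext i j
  simp only [traceSnd, Matrix.of_apply, Matrix.mul_apply, Fintype.sum_prod_type,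
    Matrix.kronecker_apply, Matrix.one_apply, mul_ite, ite_mul, mul_one, mul_zero, zero_mul,
    Finset.sum_ite_eq, Finset.sum_ite_eq', Finset.mem_univ, if_true]
  simp only [Finset.mul_sum, Finset.sum_mul]
  rw [Finset.sum_comm]
  refine Finset.sum_congr rfl fun d _ => ?_
  rw [Finset.sum_comm]

end PartialTrace

-- Structure of implementations

section Implementation

variable {s m k : Type*} [Fintype s] [DecidableEq s] [Fintype m] [DecidableEq m] [Fintype k]

/-- States span the space of all matrices. -/
lemma linearMap_ext_isState {E : Type*} [AddCommGroup E] [Module ℂ E]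
    {f g : Matrix s s ℂ →ₗ[ℂ] E} (h : ∀ ρ, IsState ρ → f ρ = g ρ) : f = g := by
  -- A nonnegative spectrum is a multiple of that of a state; Hermitian matrices are differences of
  -- such, and real and imaginary parts give the rest.
  have h1 (V : Matrix s s ℂ) (hV : V ∈ Matrix.unitaryGroup s ℂ) (d : s → ℝ)
      (hd : ∀ i, 0 ≤ d i) : f (conjDiag V d) = g (conjDiag V d) := by
    rcases (Finset.sum_nonneg fun i (_ : i ∈ Finset.univ) => hd i).eq_or_lt with h0 | h0
    · have hz : d = fun i => 0 * d i := by
        ext i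
        rw [(Finset.sum_eq_zero_iff_of_nonneg fun i _ => hd i).1 h0.symm i (Finset.mem_univ i),
          mul_zero]
      rw [hz, conjDiag_smul]
      simp
    · have hs : d = fun i => (∑ j, d j) * ((∑ j, d j)⁻¹ * d i) := by
        ext i
        field_simp
      rw [hs, conjDiag_smul, map_smul, map_smul, h]
      refine isState_conjDiag hV (fun i => mul_nonneg (inv_nonneg.2 h0.le) (hd i)) ?_
      rw [← Finset.mul_sum, inv_mul_cancel₀ h0.ne']
  have h2 (A : Matrix s s ℂ) (hA : A.IsHermitian) : f A = g A := by
    obtain ⟨V, hV, d, rfl⟩ := exists_eq_conjDiag hA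
    have hd : d = fun i => max (d i) 0 + (-1) * max (-d i) 0 := by
      ext i
      rcases le_total (d i) 0 with hi | hi
      · rw [max_eq_right hi, max_eq_left (by linarith)]; ring
      · rw [max_eq_left hi, max_eq_right (by linarith)]; ring
    rw [hd, conjDiag_add, conjDiag_smul, map_add, map_add, map_smul, map_smul,
      h1 V hV _ fun i => le_max_right _ _, h1 V hV _ fun i => le_max_right _ _]
  ext1 X
  rw [← realPart_add_I_smul_imaginaryPart X, map_add, map_add, map_smul, map_smul,
    h2 _ (realPart X).2, h2 _ (imaginaryPart X).2]

/-- A family of vectors whose Gram matrix is that of a family of scalars is a multiple of it. -/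
lemma mul_eq_mul_of_gram {ι κ : Type*} [Fintype κ] {K : ι → κ → ℂ} {p : ι → ℂ}
    (h : ∀ α β, ∑ x, K α x * star (K β x) = p α * star (p β)) (α β : ι) (x : κ) :
    p β * K α x = p α * K β x := by
  -- The squared norm of `p β • K α - p α • K β` expands into Gram entries, which cancel.
  have h0 : ∑ x, (p β * K α x - p α * K β x) * star (p β * K α x - p α * K β x) = 0 := by
    have e (x : κ) : (p β * K α x - p α * K β x) * star (p β * K α x - p α * K β x)
        = p β * star (p β) * (K α x * star (K α x)) - p β * star (p α) * (K α x * star (K β x))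
          - p α * star (p β) * (K β x * star (K α x))
          + p α * star (p α) * (K β x * star (K β x)) := by
      simp only [star_sub, star_mul']
      ring
    simp only [e, Finset.sum_add_distrib, Finset.sum_sub_distrib, ← Finset.mul_sum, h]
    ring
  have h1 : ∑ x, Complex.normSq (p β * K α x - p α * K β x) = 0 := by
    simp only [RCLike.star_def, Complex.mul_conj] at h0
    exact_mod_cast h0
  have h2 := (Finset.sum_eq_zero_iff_of_nonneg fun x _ => Complex.normSq_nonneg _).1 h1 x
    (Finset.mem_univ x)
  exact sub_eq_zero.1 (Complex.normSq_eq_zero.1 h2)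

/-- The Kraus operators of the map `ρ ↦ P ρ P` are multiples of `P`. -/
lemma exists_eq_kronecker_of_kraus {A : Matrix (s × m) (s × m) ℂ} {P : Matrix s s ℂ}
    (hP : P.IsHermitian)
    (h : ∀ ρ, IsState ρ →
      traceSnd (A * (ρ ⊗ₖ (1 : Matrix m m ℂ)) * A.conjTranspose) = P * ρ * P) :
    ∃ W : Matrix m m ℂ, A = P ⊗ₖ W ∧ (P = 0 → W = 0) := by
  let f : Matrix s s ℂ →ₗ[ℂ] Matrix s s ℂ :=
    { toFun := fun X => traceSnd (A * (X ⊗ₖ (1 : Matrix m m ℂ)) * A.conjTranspose)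
      map_add' := fun X Y => by
        rw [Matrix.add_kronecker, mul_add, add_mul, traceSnd_add]
      map_smul' := fun c X => by
        rw [Matrix.smul_kronecker, Matrix.mul_smul, Matrix.smul_mul, traceSnd_smul]
        rfl }
  let g : Matrix s s ℂ →ₗ[ℂ] Matrix s s ℂ :=
    { toFun := fun X => P * X * P
      map_add' := fun X Y => by rw [mul_add, add_mul]
      map_smul' := fun c X => by rw [Matrix.mul_smul, Matrix.smul_mul]; rfl }
  have hfg : f = g := linearMap_ext_isState h
  -- By linearity the identity holds on matrix units, where its entries are the inner products of
  -- the Kraus coefficients.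
  have gram (α β : s × s) : ∑ x : m × m, A (α.1, x.1) (α.2, x.2) * star (A (β.1, x.1) (β.2, x.2))
      = P α.1 α.2 * star (P β.1 β.2) := by
    have e := congrFun (congrFun (LinearMap.congr_fun hfg (Matrix.single α.2 β.2 1)) α.1) β.1
    simp only [f, g, LinearMap.coe_mk, AddHom.coe_mk, traceSnd, Matrix.of_apply,
      Matrix.mul_apply, Fintype.sum_prod_type, Matrix.kronecker_apply, Matrix.single_apply,
      Matrix.one_apply, Matrix.conjTranspose_apply, ite_and, mul_ite, ite_mul, mul_one, mul_zero,
      zero_mul, Finset.sum_ite_eq, Finset.sum_ite_eq', Finset.mem_univ, if_true] at e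
    rw [Fintype.sum_prod_type]
    have hp : star (P β.1 β.2) = P β.2 β.1 := hP.apply β.2 β.1
    rw [hp]
    simpa using e
  have gram' := mul_eq_mul_of_gram (K := fun (α : s × s) (x : m × m) => A (α.1, x.1) (α.2, x.2))
    (p := fun α => P α.1 α.2) gram
  by_cases hP0 : P = 0
  · refine ⟨0, ?_, fun _ => rfl⟩
    subst hP0
    rw [Matrix.zero_kronecker]
    ext ⟨a, x⟩ ⟨b, y⟩
    have e := gram (a, b) (a, b)
    simp only [RCLike.star_def, Complex.mul_conj, Matrix.zero_apply, zero_mul] at e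
    have e' : ∑ x : m × m, Complex.normSq (A (a, x.1) (b, x.2)) = 0 := by
      exact_mod_cast e
    exact Complex.normSq_eq_zero.1 ((Finset.sum_eq_zero_iff_of_nonneg
      fun x _ => Complex.normSq_nonneg _).1 e' (x, y) (Finset.mem_univ _))
  · obtain ⟨a, b, hab⟩ : ∃ a b, P a b ≠ 0 := by
      by_contra! hc
      exact hP0 (Matrix.ext hc)
    -- `W` is read off at one nonzero entry of `P`; proportionality fixes all other blocks.
    refine ⟨Matrix.of fun x y => (P a b)⁻¹ * A (a, x) (b, y), ?_, fun h => absurd h hP0⟩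
    ext ⟨c, x⟩ ⟨d, y⟩
    have e : P a b * A (c, x) (d, y) = P c d * A (a, x) (b, y) := gram' (c, d) (a, b) (x, y)
    rw [Matrix.kronecker_apply, Matrix.of_apply]
    field_simp
    linear_combination e

/-- In `∑ l, P j * P l * P j = P j` the term `l = j` is already `P j`. The others are positive
semidefinite with sum zero, so each vanishes. -/
lemma IsProjectiveMeasurement.mul_eq_zero {P : k → Matrix s s ℂ} (hP : IsProjectiveMeasurement P)
    {i j : k} (hij : i ≠ j) : P i * P j = 0 := by
  classical
  have h1 : ∑ l, (P l * P j).conjTranspose * (P l * P j) = P j := by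
    calc ∑ l, (P l * P j).conjTranspose * (P l * P j) = ∑ l, P j * P l * P j := by
          refine Finset.sum_congr rfl fun l _ => ?_
          rw [Matrix.conjTranspose_mul, (hP.isHermitian l).eq, (hP.isHermitian j).eq,
            mul_assoc, ← mul_assoc (P l) (P l), hP.idempotent, mul_assoc]
      _ = P j := by rw [← Finset.sum_mul, ← Finset.mul_sum, hP.sum_eq_one, mul_one, hP.idempotent]
  rw [← Finset.add_sum_erase _ _ (Finset.mem_univ j), hP.idempotent, (hP.isHermitian j).eq,
    hP.idempotent, add_eq_left] at h1
  have h2 := congrArg Matrix.trace h1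
  rw [Matrix.trace_sum, Matrix.trace_zero] at h2
  have h3 := (Finset.sum_eq_zero_iff_of_nonneg fun l _ =>
    (Matrix.posSemidef_conjTranspose_mul_self (P l * P j)).trace_nonneg).1 h2 i
      (Finset.mem_erase.2 ⟨hij, Finset.mem_univ i⟩)
  exact Matrix.trace_conjTranspose_mul_self_eq_zero_iff.1 h3

lemma traceSnd_postState {P : k → Matrix s s ℂ} {ρM : Matrix m m ℂ}
    {U : Matrix (s × m) (s × m) ℂ} {Q : k → Matrix m m ℂ} (hI : IsImplementation P ρM U Q)
    {ρS : Matrix s s ℂ} (hρS : IsState ρS) :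
    traceSnd (postState ρM U Q ρS) = ∑ i, P i * ρS * P i := by
  rw [postState, traceSnd_sum]
  exact Finset.sum_congr rfl fun i _ => hI.faithful ρS hρS i

/-- The structure of implementations of a projective measurement: every outcome that can occur
applies an isometry to the support of the memory state, with mutually orthogonal ranges. -/
theorem IsImplementation.exists_isometries {P : k → Matrix s s ℂ} {ρM : Matrix m m ℂ}
    {U : Matrix (s × m) (s × m) ℂ} {Q : k → Matrix m m ℂ} (hP : IsProjectiveMeasurement P)
    (hI : IsImplementation P ρM U Q) :
    ∃ W : k → Matrix m m ℂ,
      (∀ ρS, postMemory ρM U Q ρS = ∑ i, (P i * ρS).trace • (W i * (W i).conjTranspose)) ∧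
      (∀ i, P i ≠ 0 → (W i).conjTranspose * W i = ρM) ∧
      ∀ i j, i ≠ j → (W i).conjTranspose * W j = 0 := by
  obtain ⟨R, hR, hRR⟩ : ∃ R : Matrix m m ℂ, R.conjTranspose = R ∧ R * R = ρM := by
    obtain ⟨V, hV, p, rfl, hp, -⟩ := hI.isState.exists_eq_conjDiag
    refine ⟨conjDiag V fun i => Real.sqrt (p i), isHermitian_conjDiag _ _, ?_⟩
    rw [conjDiag_mul hV]
    congr 1
    ext i
    exact Real.mul_self_sqrt (hp i)
  have hU : U.conjTranspose * U = 1 := (Unitary.mem_iff.1 hI.unitary).1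
  let A (i : k) : Matrix (s × m) (s × m) ℂ :=
    ((1 : Matrix s s ℂ) ⊗ₖ Q i) * U * ((1 : Matrix s s ℂ) ⊗ₖ R)
  have hA (i : k) : (A i).conjTranspose
      = ((1 : Matrix s s ℂ) ⊗ₖ R) * U.conjTranspose * ((1 : Matrix s s ℂ) ⊗ₖ Q i) := by
    simp only [A, Matrix.conjTranspose_mul, Matrix.conjTranspose_kronecker,
      Matrix.conjTranspose_one, hR, (hI.projective.isHermitian i).eq, mul_assoc]
  have hout (ρS : Matrix s s ℂ) (i : k) : outcomeState ρM U (Q i) ρS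
      = A i * (ρS ⊗ₖ (1 : Matrix m m ℂ)) * (A i).conjTranspose := by
    have e : ρS ⊗ₖ ρM = ((1 : Matrix s s ℂ) ⊗ₖ R) * (ρS ⊗ₖ (1 : Matrix m m ℂ))
        * ((1 : Matrix s s ℂ) ⊗ₖ R) := by
      rw [← Matrix.mul_kronecker_mul, ← Matrix.mul_kronecker_mul, one_mul, mul_one, mul_one, hRR]
    rw [outcomeState, e, hA]
    simp only [A, mul_assoc]
  have hK (i : k) := exists_eq_kronecker_of_kraus (A := A i) (hP.isHermitian i) fun ρ hρ => by
    rw [← hout, hI.faithful ρ hρ]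
  choose W hW hW0 using hK
  -- The choice `W i = 0` for impossible outcomes makes this hold without a case distinction later.
  have hQW (i : k) : Q i * W i = W i := by
    by_cases h0 : P i = 0
    · rw [hW0 i h0, mul_zero]
    · refine kronecker_left_cancel h0 ?_
      rw [← hW i]
      calc P i ⊗ₖ (Q i * W i) = ((1 : Matrix s s ℂ) ⊗ₖ Q i) * A i := by
            rw [hW i, ← Matrix.mul_kronecker_mul, one_mul]
        _ = A i := by
            simp only [A, ← mul_assoc]
            rw [← Matrix.mul_kronecker_mul, one_mul, hI.projective.idempotent]
  refine ⟨W, fun ρS => ?_, fun l hl => ?_, fun i j hij => ?_⟩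
  · rw [postMemory, postState, traceFst_sum]
    refine Finset.sum_congr rfl fun i _ => ?_
    rw [hout, hW i, Matrix.conjTranspose_kronecker, ← Matrix.mul_kronecker_mul,
      ← Matrix.mul_kronecker_mul, mul_one, (hP.isHermitian i).eq, traceFst_kronecker,
      Matrix.trace_mul_comm, ← mul_assoc, hP.idempotent]
  · refine kronecker_left_cancel hl ?_
    -- The `Q i` sum to the identity, `U` cancels, and only `R * R` is left.
    have h1 : ∑ i, (A i).conjTranspose * A i = (1 : Matrix s s ℂ) ⊗ₖ ρM := by
      have e (i : k) : (A i).conjTranspose * A i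
          = ((1 : Matrix s s ℂ) ⊗ₖ R) * U.conjTranspose * ((1 : Matrix s s ℂ) ⊗ₖ Q i)
            * (U * ((1 : Matrix s s ℂ) ⊗ₖ R)) := by
        calc (A i).conjTranspose * A i
            = ((1 : Matrix s s ℂ) ⊗ₖ R) * U.conjTranspose
              * (((1 : Matrix s s ℂ) ⊗ₖ Q i) * ((1 : Matrix s s ℂ) ⊗ₖ Q i))
              * (U * ((1 : Matrix s s ℂ) ⊗ₖ R)) := by
                rw [hA]; simp only [A, mul_assoc]
          _ = _ := by rw [← Matrix.mul_kronecker_mul, one_mul, hI.projective.idempotent]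
      have e2 : ∑ i, (1 : Matrix s s ℂ) ⊗ₖ Q i = 1 := by
        rw [← Matrix.one_kronecker_one, ← hI.projective.sum_eq_one]
        ext ⟨a, x⟩ ⟨b, y⟩
        simp [Matrix.sum_apply, Finset.mul_sum]
      rw [Finset.sum_congr rfl fun i _ => e i, ← Finset.sum_mul, ← Finset.mul_sum, e2, mul_one,
        mul_assoc, ← mul_assoc _ U, hU, one_mul, ← Matrix.mul_kronecker_mul, one_mul, hRR]
    -- Multiplying by `P l ⊗ 1` isolates outcome `l`, since the `P i` are mutually orthogonal.
    have h2 := congrArg (fun X => (P l ⊗ₖ (1 : Matrix m m ℂ)) * X) h1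
    simp only [← Matrix.mul_kronecker_mul, one_mul, mul_one, Finset.mul_sum] at h2
    rw [← h2, Finset.sum_eq_single l]
    · rw [hW l, Matrix.conjTranspose_kronecker, ← Matrix.mul_kronecker_mul,
        ← Matrix.mul_kronecker_mul, (hP.isHermitian l).eq, hP.idempotent, hP.idempotent, one_mul]
    · intro i _ hi
      rw [hW i, Matrix.conjTranspose_kronecker, ← Matrix.mul_kronecker_mul,
        ← Matrix.mul_kronecker_mul, (hP.isHermitian i).eq, hP.idempotent, hP.mul_eq_zero hi.symm,
        Matrix.zero_kronecker]
    · simp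
  · rw [← hQW i, ← hQW j, Matrix.conjTranspose_mul, (hI.projective.isHermitian i).eq, mul_assoc,
      ← mul_assoc (Q i), hI.projective.mul_eq_zero hij, zero_mul, mul_zero]

lemma IsProjectiveMeasurement.trace_mul_eq {P : k → Matrix s s ℂ}
    (hP : IsProjectiveMeasurement P) {ρ : Matrix s s ℂ} (hρ : IsState ρ) (i : k) :
    (P i * ρ).trace = ((P i * ρ).trace.re : ℂ) ∧ 0 ≤ (P i * ρ).trace.re := by
  have e : (P i * ρ).trace = (P i * ρ * (P i).conjTranspose).trace := by
    rw [(hP.isHermitian i).eq, Matrix.trace_mul_comm _ (P i), ← mul_assoc, hP.idempotent]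
  have h := (hρ.posSemidef.mul_mul_conjTranspose_same (P i)).trace_nonneg
  rw [← e, Complex.nonneg_iff] at h
  exact ⟨Complex.ext rfl h.2.symm, h.1⟩

lemma sum_negMulLog_mul {ι κ : Type*} [Fintype ι] [Fintype κ] {p : ι → ℝ} {r : κ → ℝ}
    (hp : ∑ i, p i = 1) (hr : ∑ j, r j = 1) :
    ∑ x : ι × κ, Real.negMulLog (p x.1 * r x.2)
      = ∑ i, Real.negMulLog (p i) + ∑ j, Real.negMulLog (r j) := by
  simp only [Fintype.sum_prod_type, Real.negMulLog_mul, Finset.sum_add_distrib, ← Finset.mul_sum,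
    ← Finset.sum_mul, hp, hr, one_mul]

/-- The measurement raises the entropy of the memory by the entropy of the outcome. -/
theorem IsImplementation.postMemory_spec {P : k → Matrix s s ℂ} {ρM : Matrix m m ℂ}
    {U : Matrix (s × m) (s × m) ℂ} {Q : k → Matrix m m ℂ} (hP : IsProjectiveMeasurement P)
    (hI : IsImplementation P ρM U Q) {ρS : Matrix s s ℂ} (hρS : IsState ρS) :
    IsState (postMemory ρM U Q ρS) ∧
    entropy (postMemory ρM U Q ρS)
      = shannonEntropy (fun i => (P i * ρS).trace.re) + entropy ρM := by
  classical
  obtain ⟨W, hpost, hW, hWW⟩ := hI.exists_isometries hP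
  obtain ⟨V, hV, r, hr, -, hr1⟩ := hI.isState.exists_eq_conjDiag
  set p : k → ℝ := fun i => (P i * ρS).trace.re with hp
  have hp0 (i : k) : 0 ≤ p i := (hP.trace_mul_eq hρS i).2
  have hp1 : ∑ i, p i = 1 := by
    rw [← Complex.ofReal_inj, Complex.ofReal_sum,
      Finset.sum_congr rfl fun i _ => ((hP.trace_mul_eq hρS i).1).symm, ← Matrix.trace_sum,
      ← Finset.sum_mul, hP.sum_eq_one, one_mul, hρS.trace_eq_one, Complex.ofReal_one]
  -- The blocks `√p_i W i` side by side: `B * B†` is the memory state, and `B† * B` is `diag(p) ⊗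
  -- ρM`.
  let B : Matrix m (k × m) ℂ := Matrix.of fun x y => (Real.sqrt (p y.1) : ℂ) * W y.1 x y.2
  have sq (i : k) : (Real.sqrt (p i) : ℂ) * Real.sqrt (p i) = p i := by
    exact_mod_cast Real.mul_self_sqrt (hp0 i)
  have hBB : postMemory ρM U Q ρS = B * B.conjTranspose := by
    rw [hpost]
    ext x y
    simp only [Matrix.sum_apply, Matrix.smul_apply, Matrix.mul_apply, Matrix.conjTranspose_apply,
      Fintype.sum_prod_type, B, Matrix.of_apply, star_mul', smul_eq_mul]
    refine Finset.sum_congr rfl fun i _ => ?_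
    rw [(hP.trace_mul_eq hρS i).1, ← sq i, Finset.mul_sum]
    refine Finset.sum_congr rfl fun j _ => ?_
    simp only [RCLike.star_def, Complex.conj_ofReal]
    ring
  have hBB' : B.conjTranspose * B
      = conjDiag ((1 : Matrix k k ℂ) ⊗ₖ V) (fun x => p x.1 * r x.2) := by
    rw [← conjDiag_kronecker, ← hr]
    ext ⟨i, x⟩ ⟨j, y⟩
    have e : (B.conjTranspose * B) (i, x) (j, y)
        = Real.sqrt (p i) * Real.sqrt (p j) * ((W i).conjTranspose * W j) x y := by
      simp only [Matrix.mul_apply, Matrix.conjTranspose_apply, B, Matrix.of_apply, star_mul',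
        Finset.mul_sum]
      refine Finset.sum_congr rfl fun z _ => ?_
      simp only [RCLike.star_def, Complex.conj_ofReal]
      ring
    rw [e, conjDiag, Matrix.one_mul, Matrix.conjTranspose_one, Matrix.mul_one,
      Matrix.kronecker_apply]
    by_cases hij : i = j
    · subst hij
      rw [Matrix.diagonal_apply_eq, sq]
      -- For `P i = 0` nothing is known about `W i† W i`, but the weight `p i` vanishes.
      by_cases h0 : P i = 0
      · simp [hp, h0]
      · rw [hW i h0]
    · rw [Matrix.diagonal_apply_ne _ hij, hWW i j hij]
      simp
  have hU : (1 : Matrix k k ℂ) ⊗ₖ V ∈ Matrix.unitaryGroup (k × m) ℂ :=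
    kronecker_mem_unitaryGroup (one_mem _) hV
  refine ⟨⟨?_, ?_⟩, ?_⟩
  · rw [hBB]
    exact Matrix.posSemidef_self_mul_conjTranspose B
  · rw [hBB, Matrix.trace_mul_comm, hBB', trace_conjDiag hU, Fintype.sum_prod_type]
    simp only [← Finset.mul_sum, hr1, mul_one, hp1, Complex.ofReal_one]
  · rw [hBB, entropy_mul_conjTranspose_comm, hBB', entropy_conjDiag hU, sum_negMulLog_mul hp1 hr1,
      hr, entropy_conjDiag hV, shannonEntropy]

end Implementation

-- Expectation values

section Energy

variable {n m : Type*} [Fintype n] [Fintype m]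

lemma energy_add_left (H K X : Matrix n n ℂ) : energy (H + K) X = energy H X + energy K X := by
  simp [energy, add_mul]

lemma energy_smul_left (c : ℝ) (H X : Matrix n n ℂ) :
    energy ((c : ℂ) • H) X = c * energy H X := by
  simp [energy]

lemma energy_sub (H X Y : Matrix n n ℂ) : energy H (X - Y) = energy H X - energy H Y := by
  simp [energy, mul_sub]

lemma continuous_energy (H : Matrix n n ℂ) : Continuous (energy H) := by
  unfold energy
  fun_prop

lemma energy_conjDiag [DecidableEq n] {V : Matrix n n ℂ} (hV : V ∈ Matrix.unitaryGroup n ℂ)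
    (h p : n → ℝ) : energy (conjDiag V h) (conjDiag V p) = ∑ i, h i * p i := by
  rw [energy, conjDiag_mul hV, trace_conjDiag hV, Complex.ofReal_re]

lemma energy_kronecker_one [DecidableEq m] (H : Matrix n n ℂ) (X : Matrix (n × m) (n × m) ℂ) :
    energy (H ⊗ₖ (1 : Matrix m m ℂ)) X = energy H (traceSnd X) := by
  rw [energy, energy]
  congr 1
  simp only [Matrix.trace, Matrix.diag_apply, Matrix.mul_apply, Fintype.sum_prod_type,
    Matrix.kronecker_apply, Matrix.one_apply, mul_ite, ite_mul, mul_one, mul_zero, zero_mul,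
    Finset.sum_ite_eq, Finset.mem_univ, if_true, traceSnd, Matrix.of_apply, Finset.mul_sum]
  exact Finset.sum_congr rfl fun i _ => Finset.sum_comm

end Energy

-- The second law for resetting processes

section SecondLaw

variable {m : Type*} [Fintype m] [DecidableEq m]

namespace ResetProcess

lemma initialJoint_eq (R : ResetProcess m) (kT : ℝ) {V : Matrix m m ℂ} {p : m → ℝ}
    {W : Matrix (Fin R.dim) (Fin R.dim) ℂ} (hW : W ∈ Matrix.unitaryGroup (Fin R.dim) ℂ)
    {h : Fin R.dim → ℝ} (hH : R.HB = conjDiag W h) :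
    R.initialJoint kT (conjDiag V p)
      = conjDiag (V ⊗ₖ W) (fun x => p x.1 * gibbs kT h x.2) := by
  rw [initialJoint, hH, thermalState_conjDiag hW, conjDiag_kronecker]

lemma traceSnd_initialJoint (R : ResetProcess m) (kT : ℝ) (ρ' : Matrix m m ℂ) :
    traceSnd (R.initialJoint kT ρ') = ρ' := by
  have : Nonempty (Fin R.dim) := ⟨⟨0, R.dim_pos⟩⟩
  obtain ⟨W, hW, h, hH⟩ := exists_eq_conjDiag R.HB_isHermitian
  rw [initialJoint, traceSnd_kronecker, hH, thermalState_conjDiag hW, trace_conjDiag hW,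
    sum_gibbs, Complex.ofReal_one, one_smul]

lemma cost_eq (R : ResetProcess m) (kT : ℝ) (HM ρ' : Matrix m m ℂ) :
    R.cost kT HM ρ' = energy HM (R.finalMemory kT ρ' - ρ')
      + (energy ((1 : Matrix m m ℂ) ⊗ₖ R.HB) (R.finalJoint kT ρ')
        - energy ((1 : Matrix m m ℂ) ⊗ₖ R.HB) (R.initialJoint kT ρ')) := by
  rw [cost, energy_sub, energy_add_left, energy_add_left, energy_kronecker_one,
    energy_kronecker_one, traceSnd_initialJoint, energy_sub, finalMemory]
  ring

/-- The second law for a resetting process, with a positive definite reference state of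
eigenbasis `X` and eigenvalues `q` in place of the final state of the memory. -/
lemma le_cost (R : ResetProcess m) {kT : ℝ} (hkT : 0 < kT) (HM : Matrix m m ℂ)
    {ρ' : Matrix m m ℂ} (hρ' : IsState ρ') {X : Matrix m m ℂ} (hX : X ∈ Matrix.unitaryGroup m ℂ)
    {q : m → ℝ} (hq : ∀ i, 0 < q i) (hq1 : ∑ i, q i = 1) :
    energy HM (R.finalMemory kT ρ' - ρ') + kT * (entropy ρ'
        + energy (conjDiag X fun i => Real.log (q i)) (R.finalMemory kT ρ'))
      ≤ R.cost kT HM ρ' := by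
  have : Nonempty (Fin R.dim) := ⟨⟨0, R.dim_pos⟩⟩
  obtain ⟨W, hW, h, hH⟩ := exists_eq_conjDiag R.HB_isHermitian
  obtain ⟨V, hV, p, rfl, hp, hp1⟩ := hρ'.exists_eq_conjDiag
  set g := gibbs kT h with hg
  have hg0 : ∀ i, 0 < g i := gibbs_pos kT h
  have hg1 : ∑ i, g i = 1 := sum_gibbs kT h
  set G := conjDiag W fun i => Real.log (g i) with hG
  set c := Real.log (∑ j, Real.exp (-(kT⁻¹ * h j))) with hc
  have hVW := kronecker_mem_unitaryGroup hV hW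
  have hXW := kronecker_mem_unitaryGroup hX hW
  have hI : R.initialJoint kT (conjDiag V p) = conjDiag (V ⊗ₖ W) (fun x => p x.1 * g x.2) :=
    R.initialJoint_eq kT hW hH
  have hF : R.finalJoint kT (conjDiag V p)
      = conjDiag (R.U * (V ⊗ₖ W)) (fun x => p x.1 * g x.2) := by
    rw [finalJoint, hI, mul_conjDiag_mul]
  have hUVW : R.U * (V ⊗ₖ W) ∈ Matrix.unitaryGroup (m × Fin R.dim) ℂ := mul_mem R.unitary hVW
  -- The final joint state keeps the eigenvalues of the initial one; the reference is the product of
  -- the memory reference and the thermal state.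
  have klein := entropy_le_neg_trace_mul_log hUVW hXW (p := fun x => p x.1 * g x.2)
    (q := fun x => q x.1 * g x.2) (fun x => mul_nonneg (hp _) (hg0 _).le)
    (fun x => mul_pos (hq _) (hg0 _)) (by
      simp only [Fintype.sum_prod_type, ← Finset.mul_sum, hg1, mul_one, hp1, hq1])
  have hlog : conjDiag (X ⊗ₖ W) (fun x => Real.log (q x.1 * g x.2))
      = (conjDiag X fun i => Real.log (q i)) ⊗ₖ (1 : Matrix (Fin R.dim) (Fin R.dim) ℂ)
        + (1 : Matrix m m ℂ) ⊗ₖ G := by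
    rw [← conjDiag_one hW, ← conjDiag_one hX, hG, conjDiag_kronecker, conjDiag_kronecker,
      ← conjDiag_add]
    congr 1
    ext x
    rw [Real.log_mul (hq _).ne' (hg0 _).ne', one_mul, mul_one]
  rw [sum_negMulLog_mul hp1 hg1, hlog, ← hF, Matrix.trace_mul_comm, ← energy, energy_add_left,
    energy_kronecker_one, ← finalMemory] at klein
  have hbath : ∑ j, Real.negMulLog (g j)
      = -energy ((1 : Matrix m m ℂ) ⊗ₖ G) (R.initialJoint kT (conjDiag V p)) := by
    rw [hI, ← conjDiag_one hV, hG, conjDiag_kronecker, energy_conjDiag hVW,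
      Fintype.sum_prod_type_right, ← Finset.sum_neg_distrib]
    refine Finset.sum_congr rfl fun j _ => ?_
    have e (i : m) : 1 * Real.log (g j) * (p i * g j) = p i * (g j * Real.log (g j)) := by ring
    simp only [e]
    rw [← Finset.sum_mul, hp1, one_mul, Real.negMulLog, neg_mul]
  -- The logarithm of the thermal state is `-log Z - HB / kT`; the constant drops out because the
  -- trace is preserved.
  have hGH : (1 : Matrix m m ℂ) ⊗ₖ G
      = ((-c : ℝ) : ℂ) • (1 : Matrix (m × Fin R.dim) (m × Fin R.dim) ℂ)
        + ((-kT⁻¹ : ℝ) : ℂ) • ((1 : Matrix m m ℂ) ⊗ₖ R.HB) := by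
    have e : (fun i => Real.log (g i)) = fun i => -c * 1 + -kT⁻¹ * h i := by
      ext i
      rw [hg, log_gibbs]
      ring
    rw [hG, e, conjDiag_add, conjDiag_smul W (-c) (fun _ => 1), conjDiag_one hW,
      conjDiag_smul, ← hH, Matrix.kronecker_add, Matrix.kronecker_smul, Matrix.kronecker_smul,
      Matrix.one_kronecker_one]
  have htr : energy (1 : Matrix (m × Fin R.dim) (m × Fin R.dim) ℂ)
        (R.finalJoint kT (conjDiag V p))
      = energy (1 : Matrix (m × Fin R.dim) (m × Fin R.dim) ℂ)
        (R.initialJoint kT (conjDiag V p)) := by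
    rw [energy, energy, one_mul, one_mul, hF, hI, trace_conjDiag hUVW, trace_conjDiag hVW]
  rw [hbath, hGH, energy_add_left, energy_smul_left, energy_smul_left, energy_add_left,
    energy_smul_left, energy_smul_left, htr] at klein
  rw [cost_eq, entropy_conjDiag hV]
  have hk : kT * kT⁻¹ = 1 := mul_inv_cancel₀ hkT.ne'
  have := mul_le_mul_of_nonneg_left klein hkT.le
  linear_combination this + (energy ((1 : Matrix m m ℂ) ⊗ₖ R.HB) (R.finalJoint kT (conjDiag V p))
        - energy ((1 : Matrix m m ℂ) ⊗ₖ R.HB) (R.initialJoint kT (conjDiag V p))) * hk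

end ResetProcess

end SecondLaw

-- Removing zeros from a distribution

section Smoothing

variable {m : Type*} [Fintype m]

/-- The mixture of a distribution with the uniform distribution. -/
def mixUniform (r : m → ℝ) (ε : ℝ) (i : m) : ℝ := (1 - ε) * r i + ε * (Fintype.card m : ℝ)⁻¹

lemma mixUniform_zero (r : m → ℝ) : mixUniform r 0 = r := by
  ext i
  simp [mixUniform]

lemma continuous_mixUniform (r : m → ℝ) : Continuous (mixUniform r) := by
  unfold mixUniform
  fun_prop

lemma mixUniform_pos {r : m → ℝ} (hr : ∀ i, 0 ≤ r i) {ε : ℝ} (h0 : 0 < ε) (h1 : ε < 1) (i : m) :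
    0 < mixUniform r ε i := by
  have : 0 < Fintype.card m := Fintype.card_pos_iff.2 ⟨i⟩
  have := mul_nonneg (sub_nonneg.2 h1.le) (hr i)
  have : 0 < ε * (Fintype.card m : ℝ)⁻¹ := by positivity
  unfold mixUniform
  linarith

lemma sum_mixUniform {r : m → ℝ} (hr : ∑ i, r i = 1) (ε : ℝ) : ∑ i, mixUniform r ε i = 1 := by
  have : Nonempty m := by
    by_contra h
    rw [not_nonempty_iff] at h
    simp at hr
  simp only [mixUniform, Finset.sum_add_distrib, ← Finset.mul_sum, hr, Finset.sum_const,
    Finset.card_univ, nsmul_eq_mul]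
  rw [mul_inv_cancel₀ (by positivity)]
  ring

/-- Where `r i = 0` the divergent logarithm has weight zero; elsewhere the logarithm is continuous.
-/
lemma tendsto_mul_log_mixUniform (r : m → ℝ) (i : m) :
    Filter.Tendsto (fun ε => r i * Real.log (mixUniform r ε i)) (𝓝 0)
      (𝓝 (r i * Real.log (r i))) := by
  by_cases h : r i = 0
  · simp [h]
  · have h1 : Filter.Tendsto (fun ε => mixUniform r ε i) (𝓝 0) (𝓝 (r i)) := by
      have := ((continuous_apply i).comp (continuous_mixUniform r)).tendsto 0
      simpa [mixUniform_zero, Function.comp_def] using this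
    exact (h1.log h).const_mul _

end Smoothing

-- Lower bound on the reset cost

section LowerBound

variable {m : Type*} [Fintype m] [DecidableEq m]

/-- No resetting process that ends close to `ρ` costs less than the free energy difference. -/
lemma exists_nhds_le_cost {kT : ℝ} (hkT : 0 < kT) (HM : Matrix m m ℂ) {ρ ρ' : Matrix m m ℂ}
    (hρ : IsState ρ) (hρ' : IsState ρ') {c : ℝ}
    (hc : c < freeEnergy kT HM ρ - freeEnergy kT HM ρ') :
    ∃ V ∈ 𝓝 ρ, ∀ R : ResetProcess m, R.finalMemory kT ρ' ∈ V → c ≤ R.cost kT HM ρ' := by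
  obtain ⟨X, hX, r, rfl, hr, hr1⟩ := hρ.exists_eq_conjDiag
  let L (ε : ℝ) := conjDiag X fun i => Real.log (mixUniform r ε i)
  let g (ε : ℝ) (σ : Matrix m m ℂ) : ℝ :=
    energy HM (σ - ρ') + kT * (entropy ρ' + energy (L ε) σ)
  have hlim : Filter.Tendsto (fun ε => g ε (conjDiag X r)) (𝓝[>] 0)
      (𝓝 (freeEnergy kT HM (conjDiag X r) - freeEnergy kT HM ρ')) := by
    have h1 : Filter.Tendsto (fun ε => energy (L ε) (conjDiag X r)) (𝓝[>] 0)
        (𝓝 (-entropy (conjDiag X r))) := by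
      have e : -entropy (conjDiag X r) = ∑ i, r i * Real.log (r i) := by
        rw [entropy_conjDiag hX, ← Finset.sum_neg_distrib]
        exact Finset.sum_congr rfl fun i _ => by rw [Real.negMulLog]; ring
      rw [e]
      simp only [L, energy_conjDiag hX, mul_comm (Real.log _)]
      exact (tendsto_finsetSum _ fun i _ => tendsto_mul_log_mixUniform r i).mono_left
        nhdsWithin_le_nhds
    have h2 := ((h1.const_add (entropy ρ')).const_mul kT).const_add
      (energy HM (conjDiag X r - ρ'))
    refine h2.trans_eq (congrArg 𝓝 ?_)
    rw [freeEnergy, freeEnergy, energy_sub]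
    ring
  -- Fixing `ε` before the neighbourhood makes the bound `g ε` continuous in the final state.
  obtain ⟨ε, hε, h0, h1⟩ := ((hlim.eventually (lt_mem_nhds hc)).and
    ((eventually_mem_nhdsWithin (a := (0 : ℝ)) (s := Set.Ioi 0)).and
      (nhdsWithin_le_nhds (Iio_mem_nhds (one_pos (α := ℝ)))))).exists
  have hg : Continuous (g ε) :=
    ((continuous_energy HM).comp (continuous_id.sub continuous_const)).add
      (continuous_const.mul (continuous_const.add (continuous_energy (L ε))))
  exact ⟨{σ | c < g ε σ}, (isOpen_lt continuous_const hg).mem_nhds hε, fun R hR =>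
    (show c < g ε _ from hR).le.trans
      (R.le_cost hkT HM hρ' hX (mixUniform_pos hr h0 h1) (sum_mixUniform hr1 ε))⟩

end LowerBound

-- Classical resetting by permutations of levels

section Classical

universe u

variable {m : Type u} [Fintype m]

/-- A permutation of the joint levels of a memory and a bath with distribution `g` takes the
distribution `a` of the memory to `b`, and raises the energy of the bath, whose levels are
`-log g`, by `w`. -/
structure IsPermutationReset {B : Type*} [Fintype B] (a b : m → ℝ) (w : ℝ) (g : B → ℝ)
    (π : Equiv.Perm (m × B)) : Prop where
  pos : ∀ y, 0 < g y
  sum_eq_one : ∑ y, g y = 1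
  marginal : ∀ f : m → ℝ, ∑ z : m × B, f (π z).1 * (a z.1 * g z.2) = ∑ i, f i * b i
  work : ∑ z : m × B, (Real.log (g z.2) - Real.log (g (π z).2)) * (a z.1 * g z.2) = w

lemma isPermutationReset_refl (a : m → ℝ) :
    IsPermutationReset a a 0 (fun _ : PUnit.{u + 1} => 1) (Equiv.refl _) where
  pos _ := one_pos
  sum_eq_one := by simp
  marginal f := by simp [Fintype.sum_prod_type]
  work := by simp

/-- The bath starts in `b` and receives `a`; with levels `-log b` its energy rises by `∑ (a - b)
(-log b)`. -/
lemma isPermutationReset_swap {a b : m → ℝ} (ha : ∑ i, a i = 1) (hb : ∑ i, b i = 1)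
    (hb0 : ∀ i, 0 < b i) :
    IsPermutationReset a b (∑ i, (b i - a i) * Real.log (b i)) b (Equiv.prodComm m m) where
  pos := hb0
  sum_eq_one := hb
  marginal f := by
    simp only [Fintype.sum_prod_type_right, Equiv.prodComm_apply, Prod.fst_swap]
    refine Finset.sum_congr rfl fun y _ => ?_
    rw [← Finset.mul_sum, ← Finset.sum_mul, ha, one_mul]
  work := by
    simp only [Equiv.prodComm_apply, Prod.snd_swap, sub_mul, Finset.sum_sub_distrib]
    congr 1
    · rw [Fintype.sum_prod_type_right]
      refine Finset.sum_congr rfl fun y _ => ?_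
      calc _ = ∑ x, b y * Real.log (b y) * a x := Finset.sum_congr rfl fun x _ => by
            dsimp only
            ring
        _ = _ := by rw [← Finset.mul_sum, ha, mul_one]
    · rw [Fintype.sum_prod_type]
      refine Finset.sum_congr rfl fun y _ => ?_
      calc _ = ∑ x, a y * Real.log (b y) * b x := Finset.sum_congr rfl fun x _ => by
            dsimp only
            ring
        _ = _ := by rw [← Finset.mul_sum, hb, mul_one]

/-- Acting on the memory and the first bath, then on the memory and the second bath. -/
def composePerm {B C : Type*} (π : Equiv.Perm (m × B)) (τ : Equiv.Perm (m × C)) :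
    Equiv.Perm (m × (B × C)) where
  toFun z := ((τ ((π (z.1, z.2.1)).1, z.2.2)).1,
    ((π (z.1, z.2.1)).2, (τ ((π (z.1, z.2.1)).1, z.2.2)).2))
  invFun z := ((π.symm ((τ.symm (z.1, z.2.2)).1, z.2.1)).1,
    ((π.symm ((τ.symm (z.1, z.2.2)).1, z.2.1)).2, (τ.symm (z.1, z.2.2)).2))
  left_inv z := by simp
  right_inv z := by simp

/-- The second bath is independent of what came before, so averaging over it leaves a function of
the intermediate memory level, to which `hπ.marginal` applies. Works add because bath levels are
logarithms of product weights. -/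
lemma IsPermutationReset.trans {B C : Type*} [Fintype B] [Fintype C] {a b c : m → ℝ} {v w : ℝ}
    {g : B → ℝ} {h : C → ℝ} {π : Equiv.Perm (m × B)} {τ : Equiv.Perm (m × C)}
    (hπ : IsPermutationReset a b v g π) (hτ : IsPermutationReset b c w h τ) :
    IsPermutationReset a c (v + w) (fun y : B × C => g y.1 * h y.2) (composePerm π τ) where
  pos y := mul_pos (hπ.pos _) (hτ.pos _)
  sum_eq_one := by
    simp only [Fintype.sum_prod_type, ← Finset.mul_sum, hτ.sum_eq_one, mul_one, hπ.sum_eq_one]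
  marginal f := by
    have h1 := hπ.marginal fun i => ∑ y, f (τ (i, y)).1 * h y
    rw [← hτ.marginal f, Fintype.sum_prod_type, Fintype.sum_prod_type]
    rw [Fintype.sum_prod_type] at h1
    simp only [Fintype.sum_prod_type, composePerm, Equiv.coe_fn_mk]
    calc _ = ∑ i, ∑ y, (∑ y', f (τ ((π (i, y)).1, y')).1 * h y') * (a i * g y) := by
          refine Finset.sum_congr rfl fun i _ => Finset.sum_congr rfl fun y _ => ?_
          rw [Finset.sum_mul]
          exact Finset.sum_congr rfl fun y' _ => by ring
      _ = _ := by
          rw [h1]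
          refine Finset.sum_congr rfl fun i _ => ?_
          rw [Finset.sum_mul]
          exact Finset.sum_congr rfl fun y' _ => by ring
  work := by
    have h1 := hπ.marginal fun i => ∑ y, (Real.log (h y) - Real.log (h (τ (i, y)).2)) * h y
    rw [← hπ.work, ← hτ.work]
    rw [Fintype.sum_prod_type] at h1
    simp only [Fintype.sum_prod_type, composePerm, Equiv.coe_fn_mk]
    calc _ = ∑ i, ∑ y, ((Real.log (g y) - Real.log (g (π (i, y)).2)) * (a i * g y)
            + (∑ y', (Real.log (h y') - Real.log (h (τ ((π (i, y)).1, y')).2)) * h y')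
              * (a i * g y)) := by
          refine Finset.sum_congr rfl fun i _ => Finset.sum_congr rfl fun y _ => ?_
          rw [← mul_one ((_ - _) * (a i * g y)), ← hτ.sum_eq_one, Finset.mul_sum, Finset.sum_mul,
            ← Finset.sum_add_distrib]
          refine Finset.sum_congr rfl fun y' _ => ?_
          rw [Real.log_mul (hπ.pos _).ne' (hτ.pos _).ne',
            Real.log_mul (hπ.pos _).ne' (hτ.pos _).ne']
          ring
      _ = _ := by
          simp only [Finset.sum_add_distrib]
          rw [h1]
          congr 1
          refine Finset.sum_congr rfl fun i _ => ?_
          rw [Finset.sum_mul]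
          exact Finset.sum_congr rfl fun y' _ => by ring

/-- Used to relabel the bath by `Fin d`, as `ResetProcess` requires. -/
lemma IsPermutationReset.congr {B C : Type*} [Fintype B] [Fintype C] {a b : m → ℝ} {w : ℝ}
    {g : B → ℝ} {π : Equiv.Perm (m × B)} (h : IsPermutationReset a b w g π) (e : B ≃ C) :
    IsPermutationReset a b w (g ∘ e.symm)
      (((Equiv.refl m).prodCongr e).symm.trans (π.trans ((Equiv.refl m).prodCongr e))) where
  pos y := h.pos _
  sum_eq_one := by
    rw [← h.sum_eq_one]
    exact Equiv.sum_comp e.symm g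
  marginal f := by
    rw [← h.marginal f, ← Equiv.sum_comp ((Equiv.refl m).prodCongr e)]
    simp [Prod.map]
  work := by
    rw [← h.work, ← Equiv.sum_comp ((Equiv.refl m).prodCongr e)]
    simp [Prod.map]

/-- There is a bath and a permutation that take the memory from `a` to `b` with work `w`. -/
def Reaches (a b : m → ℝ) (w : ℝ) : Prop :=
  ∃ (B : Type u) (_ : Fintype B) (g : B → ℝ) (π : Equiv.Perm (m × B)),
    IsPermutationReset a b w g π

/-- Each step swaps the memory with a fresh bath in the next distribution. The distribution `a 0`
never serves as a bath, so it may have zeros. -/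
lemma reaches_path {a : ℕ → m → ℝ} (ha : ∀ n, ∑ i, a n i = 1) (ha0 : ∀ n i, 0 < a (n + 1) i)
    (N : ℕ) : Reaches (a 0) (a N)
      (∑ n ∈ Finset.range N, ∑ i, (a (n + 1) i - a n i) * Real.log (a (n + 1) i)) := by
  induction N with
  | zero =>
    rw [Finset.sum_range_zero]
    exact ⟨PUnit, inferInstance, _, _, isPermutationReset_refl (a 0)⟩
  | succ N ih =>
    obtain ⟨B, _, g, π, h⟩ := ih
    rw [Finset.sum_range_succ]
    exact ⟨B × m, inferInstance, _, _, h.trans (isPermutationReset_swap (ha N) (ha _) (ha0 N))⟩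

/-- The excess of the work over the entropy decrease is `u log (u / v) ≤ u (u / v - 1)`. In this
form the linear terms cancel over distributions, the entropies telescope along a path, and a
quadratic error remains. -/
lemma sub_mul_log_le {u v : ℝ} (hu : 0 ≤ u) (hv : 0 < v) :
    (v - u) * Real.log v
      ≤ (Real.negMulLog u - u) - (Real.negMulLog v - v) - 2 * (v - u) + (v - u) ^ 2 / v := by
  rcases hu.eq_or_lt with rfl | hu
  · rw [Real.negMulLog_zero, Real.negMulLog]
    have : (v - 0) ^ 2 / v = v := by field_simp; ring
    rw [this]
    linarith
  · have h := mul_le_mul_of_nonneg_left (Real.log_le_sub_one_of_pos (div_pos hu hv)) hu.le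
    rw [Real.log_div hu.ne' hv.ne'] at h
    have h2 : (v - u) ^ 2 / v = u * (u / v - 1) - u + v := by field_simp; ring
    rw [h2, Real.negMulLog, Real.negMulLog]
    linarith

/-- A memory can be driven between two distributions, the second without zeros, at a work
arbitrarily close to the entropy difference. -/
lemma exists_reaches {a b : m → ℝ} (ha : ∀ i, 0 ≤ a i) (ha1 : ∑ i, a i = 1)
    (hb : ∀ i, 0 < b i) (hb1 : ∑ i, b i = 1) {δ : ℝ} (hδ : 0 < δ) :
    ∃ w ≤ ∑ i, Real.negMulLog (a i) - ∑ i, Real.negMulLog (b i) + δ, Reaches a b w := by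
  set C := ∑ i, (b i - a i) ^ 2 / b i with hC
  -- Step `n` of `N` along the segment wastes at most `C / (N (n + 1))`; the total is `C` times a
  -- Cesàro mean of a null sequence.
  have hlim : Filter.Tendsto (fun N : ℕ => C * ((N : ℝ)⁻¹ * ∑ n ∈ Finset.range N,
      (1 / ((n : ℝ) + 1)))) Filter.atTop (𝓝 0) := by
    simpa using (tendsto_one_div_add_atTop_nhds_zero_nat (𝕜 := ℝ)).cesaro.const_mul C
  obtain ⟨N, hN, hN0⟩ := ((hlim.eventually (gt_mem_nhds hδ)).and
    (Filter.eventually_gt_atTop 0)).exists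
  have hNR : (0 : ℝ) < N := by exact_mod_cast hN0
  -- Truncation at `1` keeps `c n` a distribution for every `n`, as `reaches_path` demands.
  let t (n : ℕ) : ℝ := min ((n : ℝ) / N) 1
  have ht0 (n : ℕ) : 0 ≤ t n := le_min (by positivity) zero_le_one
  have ht1 (n : ℕ) : t n ≤ 1 := min_le_right _ _
  have hpos (n : ℕ) : 0 < t (n + 1) := lt_min (by positivity) one_pos
  have htn {n : ℕ} (hn : n ≤ N) : t n = (n : ℝ) / N :=
    min_eq_left ((div_le_one hNR).2 (by exact_mod_cast hn))
  let c (n : ℕ) (i : m) : ℝ := (1 - t n) * a i + t n * b i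
  have hc1 (n : ℕ) : ∑ i, c n i = 1 := by
    simp only [c, Finset.sum_add_distrib, ← Finset.mul_sum, ha1, hb1]
    ring
  have hcge (n : ℕ) (i : m) : t n * b i ≤ c n i :=
    le_add_of_nonneg_left (mul_nonneg (sub_nonneg.2 (ht1 n)) (ha i))
  have hc0 (n : ℕ) (i : m) : 0 ≤ c n i := (mul_nonneg (ht0 n) (hb i).le).trans (hcge n i)
  have hcpos (n : ℕ) (i : m) : 0 < c (n + 1) i :=
    (mul_pos (hpos n) (hb i)).trans_le (hcge (n + 1) i)
  have hca : c 0 = a := by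
    ext i
    simp [c, t]
  have hcb : c N = b := by
    ext i
    simp [c, htn le_rfl, div_self hNR.ne']
  have hreach := reaches_path hc1 hcpos N
  rw [hca, hcb] at hreach
  refine ⟨_, ?_, hreach⟩
  have hstep (n : ℕ) (hn : n ∈ Finset.range N) :
      ∑ i, (c (n + 1) i - c n i) * Real.log (c (n + 1) i)
        ≤ (∑ i, Real.negMulLog (c n i) - ∑ i, Real.negMulLog (c (n + 1) i))
          + C * ((N : ℝ)⁻¹ * (1 / ((n : ℝ) + 1))) := by
    have hn' : n < N := Finset.mem_range.1 hn
    have h1 (i : m) : (c (n + 1) i - c n i) ^ 2 / c (n + 1) i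
        ≤ (b i - a i) ^ 2 / b i * ((N : ℝ)⁻¹ * (1 / ((n : ℝ) + 1))) := by
      have e : c (n + 1) i - c n i = (b i - a i) / N := by
        simp only [c, htn hn'.le, htn (Nat.succ_le_of_lt hn')]
        push_cast
        field_simp
        ring
      have h2 : ((n : ℝ) + 1) / N * b i ≤ c (n + 1) i := by
        have := hcge (n + 1) i
        rw [htn (Nat.succ_le_of_lt hn')] at this
        exact_mod_cast this
      have h3 : 0 < ((n : ℝ) + 1) / N * b i := mul_pos (by positivity) (hb i)
      rw [e]
      refine (div_le_div_of_nonneg_left (sq_nonneg _) h3 h2).trans_eq ?_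
      have := (hb i).ne'
      field_simp
    calc ∑ i, (c (n + 1) i - c n i) * Real.log (c (n + 1) i)
        ≤ ∑ i, ((Real.negMulLog (c n i) - c n i) - (Real.negMulLog (c (n + 1) i) - c (n + 1) i)
            - 2 * (c (n + 1) i - c n i)
            + (b i - a i) ^ 2 / b i * ((N : ℝ)⁻¹ * (1 / ((n : ℝ) + 1)))) :=
          Finset.sum_le_sum fun i _ => (sub_mul_log_le (hc0 n i) (hcpos n i)).trans
            (add_le_add_right (h1 i) _)
      _ = _ := by
          simp only [Finset.sum_add_distrib, Finset.sum_sub_distrib, ← Finset.mul_sum, hc1,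
            ← Finset.sum_mul, ← hC]
          ring
  refine (Finset.sum_le_sum hstep).trans ?_
  rw [Finset.sum_add_distrib, Finset.sum_range_sub' fun n => ∑ i, Real.negMulLog (c n i), hca, hcb,
    ← Finset.mul_sum, ← Finset.mul_sum]
  exact add_le_add_right hN.le _

end Classical

-- Attaining the free energy difference

section Quantum

variable {m : Type*} [Fintype m] [DecidableEq m]

/-- The unitary matrix of a permutation of the basis. -/
def permUnitary {n : Type*} [DecidableEq n] (π : Equiv.Perm n) : Matrix n n ℂ :=
  (1 : Matrix n n ℂ).submatrix π.symm id

lemma conjDiag_permUnitary {n : Type*} [Fintype n] [DecidableEq n] (π : Equiv.Perm n)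
    (d : n → ℝ) : conjDiag (permUnitary π) d = conjDiag 1 (fun i => d (π.symm i)) := by
  ext i j
  by_cases hij : i = j
  · subst hij
    simp [conjDiag, permUnitary, Matrix.mul_apply, Matrix.diagonal_apply, Matrix.one_apply]
  · simp [conjDiag, permUnitary, Matrix.mul_apply, Matrix.diagonal_apply, Matrix.one_apply, hij]

lemma permUnitary_mem {n : Type*} [Fintype n] [DecidableEq n] (π : Equiv.Perm n) :
    permUnitary π ∈ Matrix.unitaryGroup n ℂ := by
  rw [Matrix.mem_unitaryGroup_iff]
  have h := conjDiag_permUnitary π (fun _ => 1)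
  simpa [conjDiag, Matrix.star_eq_conjTranspose] using h

lemma traceSnd_conjDiag {n : Type*} [Fintype n] [DecidableEq n] (X : Matrix m m ℂ)
    (d : m × n → ℝ) :
    traceSnd (conjDiag (X ⊗ₖ (1 : Matrix n n ℂ)) d) = conjDiag X (fun i => ∑ y, d (i, y)) := by
  rw [conjDiag, Matrix.conjTranspose_kronecker, Matrix.conjTranspose_one,
    traceSnd_kronecker_one_mul, conjDiag]
  congr 2
  ext i j
  by_cases hij : i = j <;> simp [traceSnd, Matrix.diagonal_apply, hij]

lemma IsPermutationReset.marginal_eq {B : Type*} [Fintype B] {a b : m → ℝ} {w : ℝ} {g : B → ℝ}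
    {π : Equiv.Perm (m × B)} (h : IsPermutationReset a b w g π) (i : m) :
    ∑ y, a (π.symm (i, y)).1 * g (π.symm (i, y)).2 = b i := by
  have e := h.marginal fun j => if j = i then 1 else 0
  rw [← Equiv.sum_comp π.symm] at e
  simpa [Fintype.sum_prod_type_right] using e

/-- A permutation of levels as a resetting process between diagonalised states. -/
lemma Reaches.exists_resetProcess {a b : m → ℝ} {w : ℝ} (h : Reaches a b w) {kT : ℝ}
    (hkT : 0 < kT) (HM : Matrix m m ℂ) {V X : Matrix m m ℂ} (hV : V ∈ Matrix.unitaryGroup m ℂ)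
    (hX : X ∈ Matrix.unitaryGroup m ℂ) :
    ∃ R : ResetProcess m, R.finalMemory kT (conjDiag V a) = conjDiag X b ∧
      R.cost kT HM (conjDiag V a)
        = energy HM (conjDiag X b - conjDiag V a) + kT * w := by
  obtain ⟨B, _, g₀, π₀, h₀⟩ := h
  obtain ⟨d, g, π, h⟩ : ∃ (d : ℕ) (g : Fin d → ℝ) (π : Equiv.Perm (m × Fin d)),
      IsPermutationReset a b w g π := ⟨_, _, _, h₀.congr (Fintype.equivFin B)⟩
  have hd : 0 < d := by
    rcases Nat.eq_zero_or_pos d with rfl | hd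
    · simpa using h.sum_eq_one
    · exact hd
  -- With these levels the partition function is `∑ g = 1`, so the thermal distribution is exactly
  -- `g`.
  set E : Fin d → ℝ := fun y => -(kT * Real.log (g y)) with hE
  have hE' : gibbs kT E = g := by
    have e (y : Fin d) : Real.exp (-(kT⁻¹ * E y)) = g y := by
      rw [hE, ← neg_mul_eq_mul_neg, neg_neg, ← mul_assoc, inv_mul_cancel₀ hkT.ne', one_mul,
        Real.exp_log (h.pos y)]
    ext y
    simp only [gibbs, e, h.sum_eq_one, inv_one, one_mul]
  have h1 : (1 : Matrix (Fin d) (Fin d) ℂ) ∈ Matrix.unitaryGroup (Fin d) ℂ := one_mem _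
  have hX1 := kronecker_mem_unitaryGroup hX h1
  have hV1 := kronecker_mem_unitaryGroup hV h1
  let R : ResetProcess m :=
    { dim := d
      dim_pos := hd
      HB := conjDiag 1 E
      HB_isHermitian := isHermitian_conjDiag _ _
      -- Rotate the memory out of its eigenbasis `V`, permute levels, rotate into the target basis
      -- `X`.
      U := (X ⊗ₖ (1 : Matrix (Fin d) (Fin d) ℂ)) * permUnitary π
        * (V ⊗ₖ (1 : Matrix (Fin d) (Fin d) ℂ)).conjTranspose
      unitary := mul_mem (mul_mem hX1 (permUnitary_mem π)) (Unitary.star_mem hV1) }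
  have hinit : R.initialJoint kT (conjDiag V a)
      = conjDiag (V ⊗ₖ (1 : Matrix (Fin d) (Fin d) ℂ)) (fun z => a z.1 * g z.2) := by
    rw [R.initialJoint_eq kT h1 rfl]
    simp only [R, hE']
  have hfinal : R.finalJoint kT (conjDiag V a)
      = conjDiag (X ⊗ₖ (1 : Matrix (Fin d) (Fin d) ℂ))
        (fun z => a (π.symm z).1 * g (π.symm z).2) := by
    have e : R.U * (V ⊗ₖ (1 : Matrix (Fin d) (Fin d) ℂ))
        = (X ⊗ₖ (1 : Matrix (Fin d) (Fin d) ℂ)) * permUnitary π := by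
      have : (V ⊗ₖ (1 : Matrix (Fin d) (Fin d) ℂ)).conjTranspose
          * (V ⊗ₖ (1 : Matrix (Fin d) (Fin d) ℂ)) = 1 := (Unitary.mem_iff.1 hV1).1
      simp only [R]
      rw [mul_assoc, this, mul_one]
    rw [ResetProcess.finalJoint, hinit]
    refine (mul_conjDiag_mul _ _ _).trans ?_
    rw [e, ← mul_conjDiag_mul, conjDiag_permUnitary, mul_conjDiag_mul, mul_one]
  have hmem : R.finalMemory kT (conjDiag V a) = conjDiag X b := by
    rw [ResetProcess.finalMemory, hfinal]
    refine (traceSnd_conjDiag X _).trans ?_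
    congr 1
    ext i
    exact h.marginal_eq i
  have hbath {Y : Matrix m m ℂ} (hY : Y ∈ Matrix.unitaryGroup m ℂ) :
      (1 : Matrix m m ℂ) ⊗ₖ R.HB
        = conjDiag (Y ⊗ₖ (1 : Matrix (Fin d) (Fin d) ℂ)) (fun z => 1 * E z.2) := by
    rw [← conjDiag_kronecker Y 1 (fun _ => 1) E, conjDiag_one hY]
  refine ⟨R, hmem, ?_⟩
  have hF : energy ((1 : Matrix m m ℂ) ⊗ₖ R.HB) (R.finalJoint kT (conjDiag V a))
      = ∑ z : m × Fin d, E (π z).2 * (a z.1 * g z.2) := by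
    rw [hfinal, hbath hX]
    refine (energy_conjDiag hX1 _ _).trans ?_
    rw [← Equiv.sum_comp π]
    simp
  have hI : energy ((1 : Matrix m m ℂ) ⊗ₖ R.HB) (R.initialJoint kT (conjDiag V a))
      = ∑ z : m × Fin d, E z.2 * (a z.1 * g z.2) := by
    rw [hinit, hbath hV]
    refine (energy_conjDiag hV1 _ _).trans ?_
    simp
  rw [R.cost_eq, hmem, hF, hI, ← h.work, Finset.mul_sum, ← Finset.sum_sub_distrib]
  congr 1
  refine Finset.sum_congr rfl fun z _ => ?_
  simp only [hE]
  ring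

/-- Some resetting process ends close to `ρ` and costs at most slightly more than the free energy
difference. -/
lemma exists_cost_le {kT : ℝ} (hkT : 0 < kT) (HM : Matrix m m ℂ) {ρ ρ' : Matrix m m ℂ}
    (hρ : IsState ρ) (hρ' : IsState ρ') {c : ℝ}
    (hc : freeEnergy kT HM ρ - freeEnergy kT HM ρ' < c) {N : Set (Matrix m m ℂ)} (hN : N ∈ 𝓝 ρ) :
    ∃ R : ResetProcess m, R.finalMemory kT ρ' ∈ N ∧ R.cost kT HM ρ' ≤ c := by
  obtain ⟨X, hX, r, rfl, hr, hr1⟩ := hρ.exists_eq_conjDiag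
  obtain ⟨V, hV, a, rfl, ha, ha1⟩ := hρ'.exists_eq_conjDiag
  have hσ : Continuous fun ε => conjDiag X (mixUniform r ε) := by
    have := continuous_mixUniform r
    unfold conjDiag
    fun_prop
  have hσ0 := hσ.tendsto 0
  simp only [mixUniform_zero] at hσ0
  -- The free energy difference for the smoothed target, continuous up to `ε = 0`.
  let F (ε : ℝ) : ℝ := energy HM (conjDiag X (mixUniform r ε) - conjDiag V a)
    + kT * (∑ i, Real.negMulLog (a i) - ∑ i, Real.negMulLog (mixUniform r ε i))
  have hF : Continuous F := by
    have h1 := continuous_mixUniform r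
    refine ((continuous_energy HM).comp (hσ.sub continuous_const)).add
      (continuous_const.mul (continuous_const.sub (continuous_finsetSum _ fun i _ => ?_)))
    exact Real.continuous_negMulLog.comp ((continuous_apply i).comp h1)
  have hF0 : F 0 < c := by
    refine lt_of_eq_of_lt ?_ hc
    simp only [F, mixUniform_zero, freeEnergy, entropy_conjDiag hX, entropy_conjDiag hV, energy_sub]
    ring
  obtain ⟨ε, ⟨hε, hεN⟩, h0, h1⟩ :=
    (((((hF.tendsto 0).eventually (gt_mem_nhds hF0)).and (hσ0.eventually hN)).filter_mono
      (nhdsWithin_le_nhds (s := Set.Ioi (0 : ℝ)))).and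
      ((eventually_mem_nhdsWithin (a := (0 : ℝ)) (s := Set.Ioi 0)).and
        (nhdsWithin_le_nhds (Iio_mem_nhds (one_pos (α := ℝ)))))).exists
  -- The slack `(c - F ε) / kT` is the work excess that the bound `c` still allows.
  obtain ⟨w, hw, hreach⟩ := exists_reaches ha ha1 (mixUniform_pos hr h0 h1)
    (sum_mixUniform hr1 ε) (div_pos (sub_pos.2 hε) hkT)
  obtain ⟨R, hR, hcost⟩ := hreach.exists_resetProcess hkT HM hV hX
  refine ⟨R, hR ▸ hεN, ?_⟩
  rw [hcost]
  have h2 := mul_le_mul_of_nonneg_left hw hkT.le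
  rw [mul_add, mul_div_cancel₀ _ hkT.ne'] at h2
  simp only [F] at h2
  linarith

/-- The optimal cost of resetting is the free energy difference. -/
theorem optimalResetCost_eq {kT : ℝ} (hkT : 0 < kT) (HM : Matrix m m ℂ) {ρ ρ' : Matrix m m ℂ}
    (hρ : IsState ρ) (hρ' : IsState ρ') :
    optimalResetCost kT HM ρ' ρ
      = ((freeEnergy kT HM ρ - freeEnergy kT HM ρ' : ℝ) : EReal) := by
  refine le_antisymm (iSup₂_le fun N hN => EReal.le_of_forall_lt_iff_le.1 fun c hc => ?_)
    (EReal.ge_of_forall_gt_iff_ge.1 fun c hc => ?_)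
  · obtain ⟨R, hR, hcost⟩ := exists_cost_le hkT HM hρ hρ' (EReal.coe_lt_coe_iff.1 hc) hN
    exact (iInf₂_le R hR).trans (EReal.coe_le_coe_iff.2 hcost)
  · obtain ⟨N, hN, h⟩ := exists_nhds_le_cost hkT HM hρ hρ' (EReal.coe_lt_coe_iff.1 hc)
    exact (le_iInf₂ fun R hR => EReal.coe_le_coe_iff.2 (h R hR)).trans
      (le_iSup₂ (f := fun (V : Set (Matrix m m ℂ)) (_ : V ∈ 𝓝 ρ) => ⨅ R : ResetProcess m,
        ⨅ _ : R.finalMemory kT ρ' ∈ V, (R.cost kT HM ρ' : EReal)) N hN)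

end Quantum

end QMeas

end

theorem mainTheorem1 {s m k : Type*} [Fintype s] [DecidableEq s] [Fintype m] [DecidableEq m]
    [Fintype k] (kB T : ℝ) (hkB : 0 < kB) (hT : 0 < T)
    (P : k → Matrix s s ℂ) (hP : QMeas.IsProjectiveMeasurement P)
    (ρM : Matrix m m ℂ) (U : Matrix (s × m) (s × m) ℂ) (Q : k → Matrix m m ℂ)
    (hI : QMeas.IsImplementation P ρM U Q)
    (HS : Matrix s s ℂ) (hHS : HS.IsHermitian) (HM : Matrix m m ℂ) (hHM : HM.IsHermitian)
    (ρS : Matrix s s ℂ) (hρS : QMeas.IsState ρS) :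
    -- the measurement step together with the resetting step at its optimal cost
    ((QMeas.measurementCost HS HM ρM U Q ρS : ℝ) : EReal)
        + QMeas.optimalResetCost (kB * T) HM (QMeas.postMemory ρM U Q ρS) ρM
      = ((QMeas.systemEnergyChange HS P ρS
          + kB * T * QMeas.shannonEntropy (fun i => (P i * ρS).trace.re) : ℝ) : EReal) ∧
    -- the same with the cost of the resetting step given by the free energy difference
    QMeas.measurementCost HS HM ρM U Q ρS
        + (QMeas.freeEnergy (kB * T) HM ρM
          - QMeas.freeEnergy (kB * T) HM (QMeas.postMemory ρM U Q ρS))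
      = QMeas.systemEnergyChange HS P ρS
          + kB * T * QMeas.shannonEntropy (fun i => (P i * ρS).trace.re) := by
  have hkT : 0 < kB * T := mul_pos hkB hT
  obtain ⟨hstate, hent⟩ := hI.postMemory_spec hP hρS
  have hfree : QMeas.measurementCost HS HM ρM U Q ρS
      + (QMeas.freeEnergy (kB * T) HM ρM
        - QMeas.freeEnergy (kB * T) HM (QMeas.postMemory ρM U Q ρS))
      = QMeas.systemEnergyChange HS P ρS
        + kB * T * QMeas.shannonEntropy (fun i => (P i * ρS).trace.re) := by
    -- The energies of the memory cancel for every `HM`, leaving `kT` times its entropy growth.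
    rw [QMeas.measurementCost, QMeas.traceSnd_postState hI hρS, QMeas.systemEnergyChange,
      QMeas.freeEnergy, QMeas.freeEnergy, hent, QMeas.energy_sub HM]
    ring
  refine ⟨?_, hfree⟩
  rw [QMeas.optimalResetCost_eq hkT HM hI.isState hstate, ← EReal.coe_add, hfree]
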